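/- Consider the control-affine system $\dot x = f(x) + g(x)u$, $x\in\mathbb{R}^n$, $u\in\mathbb{R}^m$, with $f:\mathbb{R}^n\to\mathbb{R}^n$ and $g:\mathbb{R}^n\to\mathbb{R}^{n\times m}$ smooth, and let $g_1,\dots,g_m$ be the columns of $g$. An extended class-$\mathcal{K}$ function is a continuous strictly increasing $\alpha:\mathbb{R}\to\mathbb{R}$ with $\alpha(0)=0$; it acts on symmetric matrices spectrally (i.e. on the eigenvalues). For a vector field $F$ and a matrix-valued function $M$ let $L_F M$ denote the entrywise Lie derivative. Let $H:\mathbb{R}^n\to\mathbb{S}^p$ be a smooth function with values in the real symmetric $p\times p$ matrices, let $\alpha_1,\dots,\alpha_{r-1}$ be smooth extended class-$\mathcal{K}$ functions, and put $$\Psi_1=H,\qquad \Psi_{i+1}=L_f\Psi_i+\alpha_i(\Psi_i)\quad(1\le i\le r-1),$$ where $r\ge 1$ is the first level at which the input appears: $L_{g_j}\Psi_i\equiv 0$ for all $j$ and all $i<r$, and $L_{g_j}\Psi_r\not\equiv 0$ for some $j$. Let $\mathcal{C}_i=\{x:\Psi_i(x)\succeq 0\}$, $\mathcal{C}=\bigcap_{i=1}^r\mathcal{C}_i$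 and $\dot\Psi_r(x,u)=L_f\Psi_r(x)+\sum_{j=1}^m u_jL_{g_j}\Psi_r(x)$. Suppose $H$ is an optimal-decay high-order matrix control barrier function (OD-HOMCBF), that is, there is an extended class-$\mathcal{K}$ function $\alpha_r$ such that for every $x\in\mathcal{C}$ there are $u\in\mathbb{R}^m$ and $\omega\ge 0$ with $\dot\Psi_r(x,u)\succ-\omega\,\alpha_r(\Psi_r(x))$; fix such an $\alpha_r$. Call $\mathcal{C}$ forward invariant for $\dot x=F(x)$ if every solution defined on a time interval starting at $0$ with $x(0)\in\mathcal{C}$ stays in $\mathcal{C}$ on that whole interval. 1. Let $k:\mathbb{R}^n\to\mathbb{R}^m$ be continuous and $\theta:\mathbb{R}^n\to\mathbb{R}_{\ge 0}$ be such that $\dot\Psi_r(x,k(x))\succeq-\theta(x)\,\alpha_r(\Psi_r(x))$ for all $x$ in an open neighborhood of $\mathcal{C}$. Then $\mathcal{C}$ is forward invariant for the closed-loop system $\dot x=f(x)+g(x)k(x)$. 2. Let $k_{\rm nom}:\mathbb{R}^n\to\mathbb{R}^m$ be continuous, $w>0$ and $\theta_d\in\mathbb{R}$. There is an open neighborhood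 $U$ of $\mathcal{C}$ such that for every $x\in U$ the semidefinite program $$\min_{u\in\mathbb{R}^m,\ \omega\ge 0}\ \|u-k_{\rm nom}(x)\|^2+w(\omega-\theta_d)^2\quad\text{s.t.}\quad \dot\Psi_r(x,u)\succeq-\omega\,\alpha_r(\Psi_r(x)),\quad \omega\ge\theta_d$$ has a unique solution $(k(x),\theta(x))$; the maps $k$ and $\theta$ are continuous on $U$; and, whatever values $k$ takes outside $U$, the set $\mathcal{C}$ is forward invariant for the closed-loop system $\dot x=f(x)+g(x)k(x)$. -/

import Mathlib

open scoped ContDiff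

noncomputable section

namespace MatrixCBF

/-- `ℝⁿ` with its Euclidean norm. -/
abbrev Vec (n : ℕ) := EuclideanSpace ℝ (Fin n)

/-- Real `p × p` matrices. -/
abbrev Mat (p : ℕ) := Matrix (Fin p) (Fin p) ℝ

/-- A continuous-time control-affine system `ẋ = f(x) + g(x) u` on `ℝⁿ` with inputs in `ℝᵐ`,
with smooth drift `f` and smooth control matrix `g`. -/
structure ControlAffineSystem (n m : ℕ) where
  /-- drift vector field -/
  f : Vec n → Vec n
  /-- control matrix -/
  g : Vec n → Matrix (Fin n) (Fin m) ℝ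
  smooth_f : ContDiff ℝ ∞ f
  smooth_g : ∀ i j, ContDiff ℝ ∞ (fun x => g x i j)

/-- The `j`-th column `g_j` of the control matrix, as a vector field. -/
def ControlAffineSystem.gcol {n m : ℕ} (S : ControlAffineSystem n m) (j : Fin m) :
    Vec n → Vec n :=
  fun x => WithLp.toLp 2 (fun i => S.g x i j)

/-- The closed-loop vector field `x ↦ f(x) + g(x) k(x)` under the state feedback `u = k(x)`. -/
def ControlAffineSystem.closedLoop {n m : ℕ} (S : ControlAffineSystem n m)
    (k : Vec n → Vec m) : Vec n → Vec n :=
  fun x => S.f x + WithLp.toLp 2 (Matrix.mulVec (S.g x) (k x).ofLp)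

/-- Forward invariance of `C` for `ẋ = F(x)`: every (classical) solution on a time interval
`[0, T]` that starts in `C` stays in `C` on that interval. Solutions on `[0, T)` or `[0, ∞)` are
covered through their restrictions to compact intervals; solutions need not be unique or
global. -/
def ForwardInvariant {n : ℕ} (F : Vec n → Vec n) (C : Set (Vec n)) : Prop :=
  ∀ (T : ℝ) (x : ℝ → Vec n),
    (∀ t ∈ Set.Icc 0 T, HasDerivWithinAt x (F (x t)) (Set.Icc 0 T) t) →
    x 0 ∈ C → ∀ t ∈ Set.Icc 0 T, x t ∈ C

/-- Extended class-`𝒦` functions. -/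
structure IsExtendedClassK (α : ℝ → ℝ) : Prop where
  continuous : Continuous α
  strictMono : StrictMono α
  map_zero : α 0 = 0

/-- The entrywise Lie derivative of a matrix-valued function `M` along a vector field `F`. -/
def lieDeriv {n p : ℕ} (F : Vec n → Vec n) (M : Vec n → Mat p) : Vec n → Mat p :=
  fun x => Matrix.of (fun a b => fderiv ℝ (fun y => M y a b) x (F x))

/-- The sequence `Ψ₁ = H`, `Ψ_{i+1} = L_f Ψ_i + α_i(Ψ_i)` for `i ≥ 1`, where the scalar function
`α_i` acts spectrally on symmetric matrices. The index `0` is not used. -/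
def Psi {n m p : ℕ} (S : ControlAffineSystem n m) (H : Vec n → Mat p) (α : ℕ → ℝ → ℝ) :
    ℕ → Vec n → Mat p
  | 0 => H
  | 1 => H
  | i + 2 => fun x => lieDeriv S.f (Psi S H α (i + 1)) x + cfc (α (i + 1)) (Psi S H α (i + 1) x)

/-- `dot Ψ (x, u) = L_f Ψ(x) + ∑ⱼ u_j L_{g_j} Ψ(x)`. -/
def matDot {n m p : ℕ} (S : ControlAffineSystem n m) (M : Vec n → Mat p) (x : Vec n)
    (u : Vec m) : Mat p :=
  lieDeriv S.f M x + ∑ j, u j • lieDeriv (S.gcol j) M x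

/-- The intersection of the sets `C_i = {x | Ψ_i(x) ⪰ 0}` over `i = 1, …, r`. -/
def safeSet {n m p : ℕ} (S : ControlAffineSystem n m) (H : Vec n → Mat p) (α : ℕ → ℝ → ℝ)
    (r : ℕ) : Set (Vec n) :=
  ⋂ i ∈ Set.Icc 1 r, {x | (Psi S H α i x).PosSemidef}

/-- The data for the high-order construction of order `r`: `H` is a smooth symmetric-matrix-valued
function, `α₁, …, α_{r-1}` are smooth extended class-`𝒦` functions, and `r ≥ 1` is the first
level at which some `L_{g_j} Ψ_r` does not vanish identically. -/
structure IsHighOrderData {n m p : ℕ} (S : ControlAffineSystem n m) (H : Vec n → Mat p)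
    (α : ℕ → ℝ → ℝ) (r : ℕ) : Prop where
  symm : ∀ x, (H x).IsSymm
  smooth : ∀ a b, ContDiff ℝ ∞ (fun x => H x a b)
  classK : ∀ i, 1 ≤ i → i < r → IsExtendedClassK (α i)
  smooth_classK : ∀ i, 1 ≤ i → i < r → ContDiff ℝ ∞ (α i)
  one_le : 1 ≤ r
  input_vanishes : ∀ i, 1 ≤ i → i < r → ∀ j x, lieDeriv (S.gcol j) (Psi S H α i) x = 0
  input_appears : ∃ j x, lieDeriv (S.gcol j) (Psi S H α r) x ≠ 0

/-- The extended class-`𝒦` function `αr` certifies the optimal-decay condition: at each `x` in the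
intersection of the sets `C_i` there are `u` and `c ≥ 0` with
`dot Ψ_r (x, u) ≻ - c αr(Ψ_r(x))`. A function `H` with such an `αr` is an optimal-decay high-order
matrix control barrier function. -/
structure IsODCertificate {n m p : ℕ} (S : ControlAffineSystem n m) (H : Vec n → Mat p)
    (α : ℕ → ℝ → ℝ) (r : ℕ) (αr : ℝ → ℝ) : Prop where
  classK : IsExtendedClassK αr
  strict : ∀ x ∈ safeSet S H α r, ∃ (u : Vec m) (c : ℝ), 0 ≤ c ∧
    (matDot S (Psi S H α r) x u - -(c • cfc αr (Psi S H α r x))).PosDef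

/-- The feasible set, at the state `x`, of the semidefinite program in `(u, ω)`: `ω ≥ 0`,
`ω ≥ θd` and `dot Ψ_r (x, u) ⪰ - ω αr(Ψ_r(x))`. -/
def sdpFeasible {n m p : ℕ} (S : ControlAffineSystem n m) (H : Vec n → Mat p)
    (α : ℕ → ℝ → ℝ) (r : ℕ) (αr : ℝ → ℝ) (θd : ℝ) (x : Vec n) : Set (Vec m × ℝ) :=
  {z | 0 ≤ z.2 ∧ θd ≤ z.2 ∧
    (matDot S (Psi S H α r) x z.1 - -(z.2 • cfc αr (Psi S H α r x))).PosSemidef}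

/-- The cost `‖u - k_nom(x)‖² + w (ω - θd)²` of the semidefinite program. -/
def sdpCost {n m : ℕ} (knom : Vec n → Vec m) (w θd : ℝ) (x : Vec n) (z : Vec m × ℝ) : ℝ :=
  ‖z.1 - knom x‖ ^ 2 + w * (z.2 - θd) ^ 2

/-- `z = (u, ω)` is an optimal solution of the semidefinite program at the state `x`. -/
def IsSDPSolution {n m p : ℕ} (S : ControlAffineSystem n m) (H : Vec n → Mat p)
    (α : ℕ → ℝ → ℝ) (r : ℕ) (αr : ℝ → ℝ) (knom : Vec n → Vec m) (w θd : ℝ) (x : Vec n)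
    (z : Vec m × ℝ) : Prop :=
  z ∈ sdpFeasible S H α r αr θd x ∧
    IsMinOn (sdpCost knom w θd x) (sdpFeasible S H α r αr θd x) z

end MatrixCBF

end

/-! ### Spectral calculus of real symmetric matrices: bounds and continuity. -/

namespace MatrixCBF

open Matrix Filter Topology

/-! Invariance rests on a matrix comparison principle, `posSemidef_of_deriv_ge`: if `Y' ⪰ -θ α(Y)`
with `θ ≥ 0` and `Y` starts positive semidefinite, it stays so. Perturb the quadratic form by `ε (1
+ t - a)|v|²`. At a first time where the perturbed form vanishes on some `v ≠ 0`, `v` is an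
eigenvector of `Y` with eigenvalue `μ < 0`, so `α(Y) v = α(μ) v` with `α(μ) ≤ 0`, and `v ⬝ Y' v ≥
0`. The perturbed form then has derivative at least `ε|v|² > 0`, although it has just come down to
its zero from positive values. Letting `ε → 0` finishes. No Lipschitz bound on `α` and no regularity
of `θ` enters.

Along a trajectory the principle is applied at level `r`, then downwards: for `i < r` the input is
absent from the derivative of `Ψ_i`, so `Ψ_{i+1} ⪰ 0` says exactly that this derivative is `⪰
-α_i(Ψ_i)`. Since the barrier inequality holds on a neighborhood of the closed safe set, continuous
induction in time globalizes the argument.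

Each `Ψ_i` must be differentiable, so smooth scalar functions must act smoothly on symmetric
matrices (`contDiff_cfc`). This comes from a Fourier series `α(M) = ∑ c_n exp(2πi n M)`: the
coefficients decay rapidly, while derivatives of order `K` of the `n`-th exponential grow only like
`|n|^K`.

For the program, `U` is the set of strictly feasible states. It is open, and it contains the safe
set because there `α_r(Ψ_r) ⪰ 0`, so `ω` can be raised to meet `ω ≥ θd`. Coercivity and strict
convexity of the cost give a unique minimizer; strict feasibility makes it continuous
(`continuousAt_of_isSDPSolution`). -/

/-- A real symmetric matrix is orthogonally diagonalizable, and the functional calculus acts on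
the diagonal. -/
theorem exists_orthogonal_diagonalization {p : ℕ} {A : Mat p} (hA : A.IsSymm) :
    ∃ (V : Mat p) (d : Fin p → ℝ), V * Vᵀ = 1 ∧ Vᵀ * V = 1 ∧ A = V * diagonal d * Vᵀ ∧
      ∀ f : ℝ → ℝ, cfc f A = V * diagonal (f ∘ d) * Vᵀ := by
  have hH : A.IsHermitian := by
    rw [IsHermitian, conjTranspose_eq_transpose_of_trivial]; exact hA
  have hstar : star (hH.eigenvectorUnitary : Mat p) = (hH.eigenvectorUnitary : Mat p)ᵀ := by
    rw [star_eq_conjTranspose, conjTranspose_eq_transpose_of_trivial]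
  refine ⟨hH.eigenvectorUnitary, hH.eigenvalues, ?_, ?_, ?_, fun f => ?_⟩
  · rw [← hstar]; exact Unitary.coe_mul_star_self _
  · rw [← hstar]; exact Unitary.coe_star_mul_self _
  · conv_lhs => rw [hH.spectral_theorem, Unitary.conjStarAlgAut_apply]
    rw [← hstar]; rfl
  · rw [hH.cfc_eq, IsHermitian.cfc, Unitary.conjStarAlgAut_apply, ← hstar]; rfl

theorem mul_diagonal_mul_transpose_apply {p : ℕ} (V : Mat p) (d : Fin p → ℝ) (a b : Fin p) :
    (V * diagonal d * Vᵀ) a b = ∑ k, V a k * d k * V b k := by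
  rw [Matrix.mul_apply]
  simp [mul_diagonal]

theorem abs_apply_le_one_of_orthogonal {p : ℕ} {V : Mat p} (hV : Vᵀ * V = 1) (i k : Fin p) :
    |V i k| ≤ 1 := by
  have h : ∑ j, V j k * V j k = 1 := by
    have := congrFun (congrFun hV k) k
    simpa [Matrix.mul_apply] using this
  have h2 : V i k * V i k ≤ 1 := by
    rw [← h]
    exact Finset.single_le_sum (f := fun j => V j k * V j k)
      (fun j _ => mul_self_nonneg _) (Finset.mem_univ i)
  exact abs_le_one_iff_mul_self_le_one.2 h2

/-- Each eigenvalue is `∑ V i k * A i j * V j k` with `|V i k| ≤ 1`. This crude bound confines the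
spectrum by a quantity visibly continuous in the entries. -/
theorem abs_le_sum_abs_of_diagonalization {p : ℕ} {A V : Mat p} {d : Fin p → ℝ}
    (hV : Vᵀ * V = 1) (hA : A = V * diagonal d * Vᵀ) (k : Fin p) :
    |d k| ≤ ∑ i, ∑ j, |A i j| := by
  have h1 : Vᵀ * A * V = diagonal d := by
    rw [hA]
    calc Vᵀ * (V * diagonal d * Vᵀ) * V = (Vᵀ * V) * diagonal d * (Vᵀ * V) := by
          simp only [Matrix.mul_assoc]
      _ = diagonal d := by rw [hV]; simp
  have h2 : d k = ∑ j, ∑ i, V i k * A i j * V j k := by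
    have := congrFun (congrFun h1 k) k
    rw [diagonal_apply_eq] at this
    rw [← this]
    simp [Matrix.mul_apply, Finset.sum_mul]
  rw [h2, Finset.sum_comm]
  refine (Finset.abs_sum_le_sum_abs _ _).trans (Finset.sum_le_sum fun i _ => ?_)
  refine (Finset.abs_sum_le_sum_abs _ _).trans (Finset.sum_le_sum fun j _ => ?_)
  rw [abs_mul, abs_mul]
  have hi := abs_apply_le_one_of_orthogonal hV i k
  have hj := abs_apply_le_one_of_orthogonal hV j k
  calc |V i k| * |A i j| * |V j k| ≤ 1 * |A i j| * 1 := by gcongr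
    _ = |A i j| := by ring

theorem cfc_isSymm {p : ℕ} {A : Mat p} (hA : A.IsSymm) (f : ℝ → ℝ) : (cfc f A).IsSymm := by
  obtain ⟨V, d, -, -, -, hf⟩ := exists_orthogonal_diagonalization hA
  rw [hf, IsSymm]
  simp [Matrix.transpose_mul, Matrix.mul_assoc]

/-- An eigenvector of `A` for `μ` is an eigenvector of `f(A)` for `f μ`. -/
theorem cfc_mulVec_of_eigenvector {p : ℕ} {A : Mat p} (hA : A.IsSymm) (f : ℝ → ℝ)
    {v : Fin p → ℝ} {μ : ℝ} (hv : A *ᵥ v = μ • v) : cfc f A *ᵥ v = f μ • v := by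
  obtain ⟨V, d, h1, h2, h3, hf⟩ := exists_orthogonal_diagonalization hA
  set w := Vᵀ *ᵥ v with hw
  have hvw : v = V *ᵥ w := by rw [hw, mulVec_mulVec, h1, one_mulVec]
  have hd : ∀ k, d k * w k = μ * w k := by
    have : diagonal d *ᵥ w = μ • w := by
      have h4 : Vᵀ *ᵥ (A *ᵥ v) = diagonal d *ᵥ w := by
        rw [h3, hw]
        simp only [mulVec_mulVec]
        congr 1
        calc Vᵀ * (V * diagonal d * Vᵀ) = (Vᵀ * V) * diagonal d * Vᵀ := by
              simp only [Matrix.mul_assoc]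
          _ = _ := by rw [h2, Matrix.one_mul]
      rw [← h4, hv, mulVec_smul]
    intro k
    have := congrFun this k
    simpa [mulVec_diagonal] using this
  -- In eigencoordinates, each `k` has either `w k = 0` or `d k = μ`.
  have hfd : diagonal (f ∘ d) *ᵥ w = f μ • w := by
    ext k
    simp only [mulVec_diagonal, Function.comp_apply, Pi.smul_apply, smul_eq_mul]
    by_cases h0 : w k = 0
    · simp [h0]
    · rw [mul_right_cancel₀ h0 (hd k)]
  rw [hf, ← mulVec_mulVec, ← mulVec_mulVec, ← hw, hfd, mulVec_smul, ← hvw]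

theorem posSemidef_iff_real {p : ℕ} {A : Mat p} :
    A.PosSemidef ↔ A.IsSymm ∧ ∀ v : Fin p → ℝ, 0 ≤ v ⬝ᵥ (A *ᵥ v) := by
  rw [posSemidef_iff_dotProduct_mulVec]
  simp [IsHermitian, IsSymm, conjTranspose_eq_transpose_of_trivial]

theorem posDef_iff_real {p : ℕ} {A : Mat p} :
    A.PosDef ↔ A.IsSymm ∧ ∀ v : Fin p → ℝ, v ≠ 0 → 0 < v ⬝ᵥ (A *ᵥ v) := by
  rw [posDef_iff_dotProduct_mulVec]
  simp [IsHermitian, IsSymm, conjTranspose_eq_transpose_of_trivial]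

theorem cfc_posSemidef {p : ℕ} {A : Mat p} (hA : A.PosSemidef) {f : ℝ → ℝ}
    (hf : ∀ t, 0 ≤ t → 0 ≤ f t) : (cfc f A).PosSemidef := by
  have hs := hA.1
  rw [hs.cfc_eq, IsHermitian.cfc, Unitary.conjStarAlgAut_apply, star_eq_conjTranspose]
  refine PosSemidef.mul_mul_conjTranspose_same (PosSemidef.diagonal fun k => ?_) _
  exact hf _ (hA.eigenvalues_nonneg k)

/-- The entries of `f(A)` and `h(A)` are close if `f` and `h` are close on the spectrum of `A`. -/
theorem abs_cfc_sub_cfc_apply_le {p : ℕ} {A : Mat p} (hA : A.IsSymm) {f h : ℝ → ℝ} {R ε : ℝ}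
    (hR : ∑ i, ∑ j, |A i j| ≤ R) (hfh : ∀ t ∈ Set.Icc (-R) R, |f t - h t| ≤ ε) (a b : Fin p) :
    |cfc f A a b - cfc h A a b| ≤ p * ε := by
  obtain ⟨V, d, -, h2, h3, hf⟩ := exists_orthogonal_diagonalization hA
  rw [hf, hf, mul_diagonal_mul_transpose_apply, mul_diagonal_mul_transpose_apply,
    ← Finset.sum_sub_distrib]
  refine (Finset.abs_sum_le_sum_abs _ _).trans ?_
  have : ∀ k ∈ (Finset.univ : Finset (Fin p)),
      |V a k * (f ∘ d) k * V b k - V a k * (h ∘ d) k * V b k| ≤ ε := fun k _ => by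
    have hd : d k ∈ Set.Icc (-R) R :=
      abs_le.1 ((abs_le_sum_abs_of_diagonalization h2 h3 k).trans hR)
    have h5 := hfh _ hd
    rw [show V a k * (f ∘ d) k * V b k - V a k * (h ∘ d) k * V b k
      = V a k * (f (d k) - h (d k)) * V b k by simp only [Function.comp_apply]; ring,
      abs_mul, abs_mul]
    have hi := abs_apply_le_one_of_orthogonal h2 a k
    have hj := abs_apply_le_one_of_orthogonal h2 b k
    calc |V a k| * |f (d k) - h (d k)| * |V b k| ≤ 1 * |f (d k) - h (d k)| * 1 := by gcongr
      _ ≤ ε := by linarith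
  refine (Finset.sum_le_sum this).trans ?_
  simp

/-- The functional calculus of a continuous function is continuous on symmetric matrices. -/
theorem continuous_cfc_of_isSymm {X : Type*} [TopologicalSpace X] {p : ℕ} {M : X → Mat p}
    (hM : Continuous M) (hs : ∀ x, (M x).IsSymm) {f : ℝ → ℝ} (hf : Continuous f) :
    Continuous fun x => cfc f (M x) := by
  refine continuous_matrix fun a b => ?_
  rw [continuous_iff_continuousAt]
  intro x₀
  refine continuousAt_of_locally_uniform_approx_of_continuousAt fun u hu => ?_
  obtain ⟨ε, hε, hu⟩ := Metric.mem_uniformity_dist.1 hu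
  set N : X → ℝ := fun x => ∑ i, ∑ j, |M x i j| with hN
  have hNc : Continuous N := by
    refine continuous_finsetSum _ fun i _ => continuous_finsetSum _ fun j _ => ?_
    exact (hM.matrix_elem i j).abs
  set R := N x₀ + 1 with hR
  have hp : (0 : ℝ) < p + 1 := by positivity
  -- Weierstrass: near `x₀` all spectra lie in `[-R, R]`, where a polynomial replaces `f` uniformly;
  -- polynomials act continuously on matrices.
  obtain ⟨q, hq⟩ := exists_polynomial_near_of_continuousOn (-R) R f hf.continuousOn
    (ε / (p + 1)) (by positivity)
  refine ⟨{x | N x < R}, hNc.continuousAt.eventually_lt continuousAt_const (by simp [hR]),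
    fun x => cfc (fun t => q.eval t) (M x) a b, ?_, fun y hy => hu ?_⟩
  · have : (fun x => cfc (fun t => q.eval t) (M x) a b)
        = fun x => (Polynomial.aeval (M x) q) a b := by
      funext x
      rw [cfc_polynomial q (M x) (by
        rw [IsSelfAdjoint, star_eq_conjTranspose, conjTranspose_eq_transpose_of_trivial]
        exact hs x)]
    rw [this]
    exact (((Polynomial.continuous_aeval q).comp hM).matrix_elem a b).continuousAt
  · rw [Real.dist_eq]
    refine (abs_cfc_sub_cfc_apply_le (hs y) (R := R) (ε := ε / (p + 1)) (le_of_lt hy)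
      (fun t ht => ?_) a b).trans_lt ?_
    · rw [abs_sub_comm]; exact (hq t ht).le
    · rw [← mul_div_assoc, div_lt_iff₀ hp]; nlinarith

end MatrixCBF

/-! ### Derivatives of powers, Fourier expansion and matrix exponentials. -/

namespace MatrixCBF

open Matrix Filter Topology

/-- Bounds of the shape `C ^ j` turn the Leibniz rule into the binomial theorem, so the order-`j`
derivative grows only like `n ^ j` in the exponent `n`. The case `j = 0` asks that `f` be a
contraction at `x`. -/
theorem norm_iteratedFDeriv_pow_le {E A : Type*} [NormedAddCommGroup E] [NormedSpace ℝ E]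
    [NormedRing A] [NormedAlgebra ℝ A] {f : E → A} (hf : ContDiff ℝ ∞ f) (h1 : ‖(1 : A)‖ ≤ 1)
    {K : ℕ} {C : ℝ} {x : E} (hb : ∀ j ≤ K, ‖iteratedFDeriv ℝ j f x‖ ≤ C ^ j) (hC : 0 ≤ C)
    (n : ℕ) : ∀ j ≤ K, ‖iteratedFDeriv ℝ j (fun y => f y ^ n) x‖ ≤ (n * C) ^ j := by
  induction n with
  | zero =>
    intro j _
    simp only [pow_zero]
    rcases Nat.eq_zero_or_pos j with rfl | hj
    · simpa using h1
    · rw [iteratedFDeriv_const_of_ne hj.ne']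
      simp [hj.ne']
  | succ n ih =>
    intro j hj
    simp only [pow_succ]
    refine (norm_iteratedFDeriv_mul_le (N := ∞) (hf.pow n) hf x
      (by exact_mod_cast le_top)).trans ?_
    have : ((n + 1 : ℕ) * C) ^ j = ∑ i ∈ Finset.range (j + 1),
        (j.choose i : ℝ) * (n * C) ^ i * C ^ (j - i) := by
      push_cast
      rw [add_mul, one_mul, add_pow]
      exact Finset.sum_congr rfl fun i _ => by ring
    rw [this]
    refine Finset.sum_le_sum fun i hi => ?_
    have hij : i ≤ j := Nat.lt_succ_iff.1 (Finset.mem_range.1 hi)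
    have h2 := ih i (hij.trans hj)
    have h3 := hb (j - i) ((Nat.sub_le _ _).trans hj)
    gcongr

open scoped SchwartzMap FourierTransform in
/-- A smooth function on a short interval is the sum of a rapidly convergent Fourier series. -/
theorem exists_fourier_expansion {α : ℝ → ℝ} (hα : ContDiff ℝ ∞ α) :
    ∃ c : ℤ → ℂ, (∀ k : ℕ, Summable fun n : ℤ => ‖c n‖ * |(n : ℝ)| ^ k) ∧
      ∀ t ∈ Set.Icc (-(1 / 4) : ℝ) (1 / 4),
        HasSum (fun n : ℤ => c n * Complex.exp (n * (2 * Real.pi * Complex.I) * t))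
          (α t : ℂ) := by
  let b : ContDiffBump (0 : ℝ) := ⟨1 / 4, 1 / 2, by norm_num, by norm_num⟩
  let h : ℝ → ℂ := fun t => ((b t * α t : ℝ) : ℂ)
  have hs : HasCompactSupport h := by
    have : HasCompactSupport fun t => b t * α t := b.hasCompactSupport.mul_right
    exact this.comp_left (g := fun t : ℝ => (t : ℂ)) (by simp)
  have hd : ContDiff ℝ ∞ h := Complex.ofRealCLM.contDiff.comp (b.contDiff.mul hα)
  let F : 𝓢(ℝ, ℂ) := hs.toSchwartzMap hd
  have hF : ∀ t, F t = h t := fun t => rfl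
  have hsum : ∀ k : ℕ, Summable fun n : ℤ => ‖𝓕 F (n : ℝ)‖ * |(n : ℝ)| ^ k := by
    intro k
    obtain ⟨C, hC, hdec⟩ := (𝓕 F).decay (k + 2) 0
    refine Summable.of_norm_bounded_eventually (g := fun n : ℤ => C * (1 / (n : ℝ) ^ 2))
      ((Real.summable_one_div_int_pow.2 (by norm_num)).mul_left C) ?_
    filter_upwards [(Set.finite_singleton (0 : ℤ)).compl_mem_cofinite] with n hn
    have hn0 : (n : ℝ) ≠ 0 := by exact_mod_cast hn
    have h1 := hdec n
    rw [norm_iteratedFDeriv_zero, Real.norm_eq_abs, pow_add, sq_abs] at h1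
    rw [Real.norm_eq_abs, abs_of_nonneg (by positivity), mul_one_div, le_div_iff₀ (by positivity)]
    linarith
  refine ⟨fun n => 𝓕 F (n : ℝ), hsum, fun t ht => ?_⟩
  have hterm : ∀ n : ℤ, 𝓕 F (n : ℝ) * fourier n (t : UnitAddCircle)
      = 𝓕 F (n : ℝ) * Complex.exp (n * (2 * Real.pi * Complex.I) * t) := fun n => by
    rw [fourier_coe_apply]
    congr 2
    push_cast
    ring
  -- Poisson summation for the cut-off function: with `|t| ≤ 1/4`, every translate by `n ≠ 0` lies
  -- outside the support of the bump, so the periodization equals `α t`.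
  have hP := F.tsum_eq_tsum_fourier t
  have hL : ∑' n : ℤ, F (t + n) = (α t : ℂ) := by
    rw [tsum_eq_single 0]
    · have : b t = 1 := b.one_of_mem_closedBall (by
        rw [Metric.mem_closedBall, dist_zero_right, Real.norm_eq_abs, abs_le]; exact ht)
      simp [hF, h, this]
    · intro n hn
      have : b (t + n) = 0 := b.zero_of_le_dist (by
        rw [dist_zero_right, Real.norm_eq_abs]
        have h1 : (1 : ℝ) ≤ |(n : ℝ)| := by exact_mod_cast Int.one_le_abs hn
        have h2 : |t| ≤ 1 / 4 := abs_le.2 ht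
        have h3 : |(n : ℝ)| ≤ |t + n| + |t| := by
          have := abs_sub (t + n) t
          simpa using this
        show (1 / 2 : ℝ) ≤ _
        linarith)
      simp [hF, h, this]
  rw [hL] at hP
  simp only [hterm] at hP
  rw [hP]
  refine Summable.hasSum (Summable.of_norm ?_)
  have h0 := hsum 0
  simp only [pow_zero, mul_one] at h0
  refine h0.congr fun n => ?_
  rw [norm_mul, show (n * (2 * Real.pi * Complex.I) * t : ℂ)
    = ((n * (2 * Real.pi) * t : ℝ) : ℂ) * Complex.I by push_cast; ring,
    Complex.norm_exp_ofReal_mul_I, mul_one]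

open scoped Matrix.Norms.L2Operator

/-- Entries of the exponential of a complex multiple of a diagonalized real symmetric matrix. -/
theorem exp_smul_map_ofReal_apply {p : ℕ} {A V : Mat p} {d : Fin p → ℝ} (hV : V * Vᵀ = 1)
    (hA : A = V * diagonal d * Vᵀ) (z : ℂ) (a b : Fin p) :
    NormedSpace.exp (z • A.map (Complex.ofReal)) a b
      = ∑ k, (V a k : ℂ) * Complex.exp (z * d k) * V b k := by
  set W : Matrix (Fin p) (Fin p) ℂ := V.map Complex.ofReal with hW
  have hWW : W * Wᵀ = 1 := by
    have := congrArg (RingHom.mapMatrix Complex.ofRealHom) hV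
    rw [map_mul, map_one] at this
    exact this
  have hinv : W⁻¹ = Wᵀ := inv_eq_right_inv hWW
  have hunit : IsUnit W := (isUnit_iff_isUnit_det _).2 (isUnit_det_of_right_inverse hWW)
  have hz : z • A.map (Complex.ofReal) = W * diagonal (fun k => z * (d k : ℂ)) * W⁻¹ := by
    rw [hinv, hA]
    ext i j
    rw [Matrix.smul_apply, map_apply, mul_diagonal_mul_transpose_apply]
    rw [Matrix.mul_apply]
    simp only [mul_diagonal, transpose_apply, hW, map_apply, smul_eq_mul]
    push_cast
    rw [Finset.mul_sum]
    exact Finset.sum_congr rfl fun k _ => by ring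
  rw [hz, Matrix.exp_conj _ _ hunit, Matrix.exp_diagonal, hinv, Matrix.mul_apply]
  simp only [mul_diagonal, transpose_apply, hW, map_apply]
  refine Finset.sum_congr rfl fun k _ => ?_
  rw [Pi.coe_exp, Complex.exp_eq_exp_ℂ]

/-- Only an inequality, since the norm is zero when `p = 0`. -/
theorem norm_one_le_one_l2 {p : ℕ} : ‖(1 : Matrix (Fin p) (Fin p) ℂ)‖ ≤ 1 := by
  have h : ‖(1 : Matrix (Fin p) (Fin p) ℂ)‖ * ‖(1 : Matrix (Fin p) (Fin p) ℂ)‖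
      = ‖(1 : Matrix (Fin p) (Fin p) ℂ)‖ := by
    rw [← CStarRing.norm_star_mul_self]; simp
  by_contra hlt
  push Not at hlt
  nlinarith

/-- The exponential of an imaginary multiple of a real symmetric matrix is a contraction. -/
theorem norm_exp_smul_map_ofReal_le {p : ℕ} {A : Mat p} (hA : A.IsSymm) (s : ℝ) :
    ‖NormedSpace.exp (((s : ℂ) * Complex.I) • A.map (Complex.ofReal))‖ ≤ 1 := by
  set B := ((s : ℂ) * Complex.I) • A.map (Complex.ofReal) with hB
  have hst : star B = -B := by
    rw [hB, star_smul, star_eq_conjTranspose]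
    have : (A.map Complex.ofReal)ᴴ = A.map Complex.ofReal := by
      ext i j
      simp [conjTranspose_apply, hA.apply i j]
    rw [this]
    simp
  have h : ‖NormedSpace.exp B‖ * ‖NormedSpace.exp B‖ ≤ 1 := by
    rw [← CStarRing.norm_star_mul_self, star_eq_conjTranspose, ← Matrix.exp_conjTranspose,
      ← star_eq_conjTranspose, hst,
      ← Matrix.exp_add_of_commute _ _ (Commute.neg_left (Commute.refl B))]
    simpa using norm_one_le_one_l2
  nlinarith [norm_nonneg (NormedSpace.exp B)]

end MatrixCBF

/-! ### Smoothness of the functional calculus. -/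

namespace MatrixCBF

open Matrix Filter Topology

section

open scoped Matrix.Norms.L2Operator

variable {E : Type*} [NormedAddCommGroup E] [NormedSpace ℝ E] {p : ℕ} {M : E → Mat p}

theorem contDiff_exp_smul_map_ofReal (hM : ∀ a b, ContDiff ℝ ∞ fun x => M x a b) (z : ℂ) :
    ContDiff ℝ ∞ fun x => NormedSpace.exp (z • (M x).map Complex.ofReal) := by
  have h1 : ContDiff ℝ ∞ fun x => z • (M x).map Complex.ofReal := by
    have : (fun x => z • (M x).map Complex.ofReal) = fun x =>
        ∑ i, ∑ j, (z * (M x i j : ℂ)) • (single i j 1 : Matrix (Fin p) (Fin p) ℂ) := by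
      funext x
      rw [matrix_eq_sum_single (z • (M x).map Complex.ofReal)]
      simp
    rw [this]
    refine ContDiff.sum fun i _ => ContDiff.sum fun j _ => ContDiff.fun_smul ?_ contDiff_const
    exact contDiff_const.mul (Complex.ofRealCLM.contDiff.comp (hM i j))
  have h2 : ContDiff ℝ ∞ (NormedSpace.exp : Matrix (Fin p) (Fin p) ℂ → _) :=
    contDiff_iff_contDiffAt.2 fun x => (NormedSpace.exp_analytic (𝕂 := ℝ) x).contDiffAt
  exact h2.comp h1

/-- The exponential is `1` off the support of `M`, so its difference from `1` is compactly supported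
and has bounded derivatives. At order zero the bound `C ^ 0 = 1` comes from contractivity instead.
-/
theorem exists_norm_iteratedFDeriv_exp_le (hM : ∀ a b, ContDiff ℝ ∞ fun x => M x a b)
    (hs : ∀ x, (M x).IsSymm) (hc : HasCompactSupport M) (s : ℝ) (K : ℕ) :
    ∃ C : ℝ, 0 ≤ C ∧ ∀ x, ∀ j ≤ K, ‖iteratedFDeriv ℝ j
      (fun x => NormedSpace.exp (((s : ℂ) * Complex.I) • (M x).map Complex.ofReal)) x‖
        ≤ C ^ j := by
  set U := fun x => NormedSpace.exp (((s : ℂ) * Complex.I) • (M x).map Complex.ofReal) with hU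
  have hUd : ContDiff ℝ ∞ U := contDiff_exp_smul_map_ofReal hM _
  have hG : HasCompactSupport fun x => U x - 1 := by
    refine hc.comp_left (g := fun A : Mat p =>
      NormedSpace.exp (((s : ℂ) * Complex.I) • A.map Complex.ofReal) - 1) ?_
    have : (0 : Mat p).map Complex.ofReal = 0 := by ext; simp
    simp [this]
  have hGd : ContDiff ℝ ∞ fun x => U x - 1 := hUd.sub contDiff_const
  have hbd : ∀ j : ℕ, ∃ B : ℝ, ∀ x, ‖iteratedFDeriv ℝ j (fun x => U x - 1) x‖ ≤ B := fun j =>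
    (hGd.continuous_iteratedFDeriv (by exact_mod_cast le_top)).bounded_above_of_compact_support
      (hG.iteratedFDeriv j)
  choose B hB using hbd
  have hB0 : ∀ j, 0 ≤ B j := fun j => (norm_nonneg _).trans (hB j 0)
  have hS : 0 ≤ ∑ j ∈ Finset.range (K + 1), B j := Finset.sum_nonneg fun j _ => hB0 j
  refine ⟨1 + ∑ j ∈ Finset.range (K + 1), B j, by positivity, fun x j hj => ?_⟩
  rcases Nat.eq_zero_or_pos j with rfl | hj0
  · simpa using norm_exp_smul_map_ofReal_le (hs x) s
  · have h1 : iteratedFDeriv ℝ j U x = iteratedFDeriv ℝ j (fun x => U x - 1) x := by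
      have h2 : U = (fun x => U x - 1) + fun _ => 1 := by ext1 x; simp
      conv_lhs => rw [h2]
      rw [iteratedFDeriv_add_apply (hGd.contDiffAt.of_le (by exact_mod_cast le_top))
        contDiffAt_const, iteratedFDeriv_const_of_ne hj0.ne']
      simp
    rw [h1]
    calc _ ≤ B j := hB j x
      _ ≤ ∑ j ∈ Finset.range (K + 1), B j :=
        Finset.single_le_sum (fun j _ => hB0 j) (Finset.mem_range.2 (by omega))
      _ ≤ 1 + ∑ j ∈ Finset.range (K + 1), B j := by linarith
      _ ≤ _ := le_self_pow₀ (by linarith) hj0.ne'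

/-- Smoothness of the functional calculus along a compactly supported family of small symmetric
matrices. -/
theorem contDiff_cfc_of_hasCompactSupport (hM : ∀ a b, ContDiff ℝ ∞ fun x => M x a b)
    (hs : ∀ x, (M x).IsSymm) (hc : HasCompactSupport M)
    (hsmall : ∀ x, ∑ i, ∑ j, |M x i j| ≤ 1 / 4) {α : ℝ → ℝ} (hα : ContDiff ℝ ∞ α)
    (a b : Fin p) : ContDiff ℝ ∞ fun x => cfc α (M x) a b := by
  obtain ⟨c, hc1, hc2⟩ := exists_fourier_expansion hα
  -- Only `σ = -1, 0, 1` matter: the `n`-th Fourier mode is `U n.sign ^ n.natAbs`, so bounds on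
  -- three functions control all modes.
  let U : ℤ → E → Matrix (Fin p) (Fin p) ℂ := fun σ x =>
    NormedSpace.exp ((((σ * (2 * Real.pi) : ℝ) : ℂ) * Complex.I) • (M x).map Complex.ofReal)
  have hUd : ∀ σ, ContDiff ℝ ∞ (U σ) := fun σ => contDiff_exp_smul_map_ofReal hM _
  have hUn : ∀ n : ℤ, ∀ x, U n.sign x ^ n.natAbs
      = NormedSpace.exp ((n * (2 * Real.pi * Complex.I)) • (M x).map Complex.ofReal) := by
    intro n x
    rw [← Matrix.exp_nsmul, ← Nat.cast_smul_eq_nsmul ℂ, smul_smul]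
    congr 2
    have : (n.natAbs : ℂ) * (n.sign : ℂ) = (n : ℂ) := by
      rw [← Int.cast_natCast, ← Int.cast_mul, mul_comm, Int.sign_mul_natAbs]
    rw [← this, Complex.ofReal_mul, Complex.ofReal_mul, Complex.ofReal_intCast,
      Complex.ofReal_ofNat]
    ring
  let ent : Matrix (Fin p) (Fin p) ℂ →L[ℝ] ℂ :=
    (LinearMap.toContinuousLinearMap (Matrix.entryLinearMap ℂ ℂ a b)).restrictScalars ℝ
  have hent : ∀ B, ent B = B a b := fun B => rfl
  let F : ℤ → E → ℂ := fun n x => c n • ent (U n.sign x ^ n.natAbs)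
  have hFd : ∀ n, ContDiff ℝ ∞ (F n) := fun n =>
    (contDiff_const (c := c n)).fun_smul (ent.contDiff.comp ((hUd n.sign).pow n.natAbs))
  have hbd : ∀ σ : ℤ, ∀ K : ℕ, ∃ C : ℝ, 0 ≤ C ∧ ∀ x, ∀ j ≤ K,
      ‖iteratedFDeriv ℝ j (U σ) x‖ ≤ C ^ j := fun σ K =>
    exists_norm_iteratedFDeriv_exp_le hM hs hc _ K
  choose C hC0 hC using hbd
  let D : ℕ → ℝ := fun K => C (-1) K + C 0 K + C 1 K
  have hD0 : ∀ K, 0 ≤ D K := fun K => add_nonneg (add_nonneg (hC0 _ _) (hC0 _ _)) (hC0 _ _)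
  have hCD : ∀ n : ℤ, ∀ K, C n.sign K ≤ D K := by
    intro n K
    have h1 := hC0 (-1) K
    have h2 := hC0 0 K
    have h3 := hC0 1 K
    rcases n.sign_trichotomy with h | h | h <;> rw [h] <;> simp only [D] <;> linarith
  have hsumC : ContDiff ℝ ∞ fun x => ∑' n, F n x := by
    refine contDiff_tsum (N := (⊤ : ℕ∞))
      (v := fun K n => (‖ent‖ * D K ^ K) * (‖c n‖ * |(n : ℝ)| ^ K)) hFd
      (fun K _ => (hc1 K).mul_left _) fun K n x _ => ?_
    have h1 : ‖iteratedFDeriv ℝ K (fun y => U n.sign y ^ n.natAbs) x‖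
        ≤ (n.natAbs * D K) ^ K :=
      norm_iteratedFDeriv_pow_le (hUd _) norm_one_le_one_l2
        (fun j hj => (hC _ K x j hj).trans (pow_le_pow_left₀ (hC0 _ _) (hCD n K) _))
        (hD0 K) _ K le_rfl
    have h2 : ‖iteratedFDeriv ℝ K (fun y => ent (U n.sign y ^ n.natAbs)) x‖
        ≤ ‖ent‖ * ‖iteratedFDeriv ℝ K (fun y => U n.sign y ^ n.natAbs) x‖ :=
      ent.norm_iteratedFDeriv_comp_left (((hUd _).pow _).contDiffAt (x := x))
        (by exact_mod_cast le_top)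
    have h3 : iteratedFDeriv ℝ K (F n) x
        = c n • iteratedFDeriv ℝ K (fun y => ent (U n.sign y ^ n.natAbs)) x :=
      iteratedFDeriv_const_smul_apply (a := c n)
        (f := fun y => ent (U n.sign y ^ n.natAbs))
        ((ent.contDiff.comp ((hUd _).pow _)).contDiffAt.of_le (by exact_mod_cast le_top))
    rw [h3, norm_smul]
    have h4 : ((n.natAbs : ℝ) * D K) ^ K = |(n : ℝ)| ^ K * D K ^ K := by
      rw [mul_pow, Nat.cast_natAbs, Int.cast_abs]
    rw [h4] at h1
    calc _ ≤ ‖c n‖ * (‖ent‖ * (|(n : ℝ)| ^ K * D K ^ K)) := by gcongr; exact h2.trans (by gcongr)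
      _ = _ := by ring
  have heq : (fun x => cfc α (M x) a b) = fun x => Complex.reCLM (∑' n, F n x) := by
    funext x
    obtain ⟨V, d, hV1, hV2, hA, hf⟩ := exists_orthogonal_diagonalization (hs x)
    have hS : HasSum (fun n => F n x) (∑ k, (V a k : ℂ) * (α (d k) : ℂ) * V b k) := by
      have : ∀ n, F n x = ∑ k, (V a k : ℂ) *
          (c n * Complex.exp (n * (2 * Real.pi * Complex.I) * d k)) * V b k := fun n => by
        simp only [F]
        rw [hent, hUn, exp_smul_map_ofReal_apply hV1 hA, smul_eq_mul, Finset.mul_sum]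
        exact Finset.sum_congr rfl fun k _ => by ring
      simp only [this]
      refine hasSum_sum fun k _ => ((hc2 (d k) ?_).mul_left _).mul_right _
      exact abs_le.1 ((abs_le_sum_abs_of_diagonalization hV2 hA k).trans (hsmall x))
    rw [hS.tsum_eq, hf, mul_diagonal_mul_transpose_apply]
    simp only [← Complex.ofReal_mul, ← Complex.ofReal_sum]
    rfl
  rw [heq]
  exact Complex.reCLM.contDiff.comp hsumC

end

/-- Smooth functions act smoothly on smooth families of symmetric matrices. -/
theorem contDiff_cfc {n p : ℕ} {M : Vec n → Mat p}
    (hM : ∀ a b, ContDiff ℝ ∞ fun x => M x a b) (hs : ∀ x, (M x).IsSymm) {α : ℝ → ℝ}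
    (hα : ContDiff ℝ ∞ α) (a b : Fin p) : ContDiff ℝ ∞ fun x => cfc α (M x) a b := by
  rw [contDiff_iff_contDiffAt]
  intro x₀
  let χ : ContDiffBump x₀ := ⟨1, 2, by norm_num, by norm_num⟩
  have hcont : Continuous fun x => ∑ i, ∑ j, |M x i j| :=
    continuous_finsetSum _ fun i _ => continuous_finsetSum _ fun j _ => (hM i j).continuous.abs
  obtain ⟨B, hB⟩ := (isCompact_closedBall x₀ 2).exists_bound_of_continuousOn hcont.continuousOn
  -- Localize and rescale: `N` has compact support and spectrum in `[-1/4, 1/4]`, and near `x₀` one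
  -- has `M = R • N`, so `α(M)` is `t ↦ α(R t)` applied to `N`.
  set R := 4 * (|B| + 1) with hR
  have hR0 : 0 < R := by positivity
  let N : Vec n → Mat p := fun x => (χ x / R) • M x
  have hN : ∀ a b, ContDiff ℝ ∞ fun x => N x a b := fun a b =>
    (χ.contDiff.div_const R).mul (hM a b)
  have hNs : ∀ x, (N x).IsSymm := fun x => (hs x).smul _
  have hNc : HasCompactSupport N := by
    refine χ.hasCompactSupport.mono' (subset_closure.trans' fun x hx => ?_)
    intro h0
    exact hx (by simp [N, h0])
  have hNb : ∀ x, ∑ i, ∑ j, |N x i j| ≤ 1 / 4 := by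
    intro x
    have h1 : ∑ i, ∑ j, |N x i j| = χ x / R * ∑ i, ∑ j, |M x i j| := by
      simp only [N, Matrix.smul_apply, smul_eq_mul, abs_mul, Finset.mul_sum]
      rw [abs_of_nonneg (div_nonneg χ.nonneg hR0.le)]
    rw [h1]
    by_cases hx : x ∈ Metric.closedBall x₀ 2
    · have h2 := hB x hx
      rw [Real.norm_eq_abs, abs_of_nonneg (by positivity)] at h2
      have h3 : χ x ≤ 1 := χ.le_one
      have h4 : 0 ≤ χ x := χ.nonneg
      rw [div_mul_eq_mul_div, div_le_iff₀ hR0]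
      have h5 : B ≤ |B| := le_abs_self B
      have h6 : 0 ≤ ∑ i, ∑ j, |M x i j| := by positivity
      nlinarith
    · have : χ x = 0 := χ.zero_of_le_dist (not_le.1 hx).le
      simp [this]
  have hα' : ContDiff ℝ ∞ fun t => α (R * t) := hα.comp (contDiff_const.mul contDiff_id)
  have hsm := contDiff_cfc_of_hasCompactSupport hN hNs hNc hNb hα' a b
  refine hsm.contDiffAt.congr_of_eventuallyEq ?_
  filter_upwards [χ.eventuallyEq_one] with x hx
  have hx1 : M x = R • N x := by
    simp only [N, hx, Pi.one_apply, smul_smul]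
    rw [mul_one_div_cancel hR0.ne', one_smul]
  have hx2 : (cfc (fun t => α (R * t)) (N x) : Mat p) = cfc α (R • N x) :=
    cfc_comp_const_mul R α (N x) hα.continuous.continuousOn (hNs x)
  exact (congrArg (fun B : Mat p => cfc α B a b) hx1).trans
    (congrArg (fun B : Mat p => B a b) hx2.symm)

end MatrixCBF

/-! ### Lie derivatives and regularity of the sequence `Ψ_i`. -/

namespace MatrixCBF

open Matrix Filter Topology Set

variable {n m p : ℕ}

theorem contDiff_lieDeriv_apply {F : Vec n → Vec n} {M : Vec n → Mat p} (hF : ContDiff ℝ ∞ F)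
    (hM : ∀ a b, ContDiff ℝ ∞ fun x => M x a b) (a b : Fin p) :
    ContDiff ℝ ∞ fun x => lieDeriv F M x a b :=
  ((hM a b).fderiv_right (m := ∞) (by simp)).clm_apply hF

theorem lieDeriv_isSymm {M : Vec n → Mat p} (hM : ∀ x, (M x).IsSymm) (F : Vec n → Vec n)
    (x : Vec n) : (lieDeriv F M x).IsSymm := by
  ext a b
  simp only [lieDeriv, transpose_apply, of_apply]
  have : (fun y => M y b a) = fun y => M y a b := funext fun y => (hM y).apply a b
  rw [this]

theorem ControlAffineSystem.contDiff_gcol (S : ControlAffineSystem n m) (j : Fin m) :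
    ContDiff ℝ ∞ (S.gcol j) :=
  contDiff_euclidean.2 fun i => S.smooth_g i j

theorem matDot_isSymm (S : ControlAffineSystem n m) {M : Vec n → Mat p}
    (hM : ∀ x, (M x).IsSymm) (x : Vec n) (u : Vec m) : (matDot S M x u).IsSymm := by
  rw [matDot, IsSymm, transpose_add, transpose_sum]
  congr 1
  · exact lieDeriv_isSymm hM _ x
  · refine Finset.sum_congr rfl fun j _ => ?_
    rw [transpose_smul, (lieDeriv_isSymm hM _ x).eq]

theorem continuous_matDot (S : ControlAffineSystem n m) {M : Vec n → Mat p}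
    (hM : ∀ a b, ContDiff ℝ ∞ fun x => M x a b) :
    Continuous fun z : Vec n × Vec m => matDot S M z.1 z.2 := by
  have h : ∀ {F : Vec n → Vec n}, ContDiff ℝ ∞ F →
      Continuous fun z : Vec n × Vec m => lieDeriv F M z.1 := fun hF =>
    continuous_matrix fun a b => (contDiff_lieDeriv_apply hF hM a b).continuous.comp continuous_fst
  unfold matDot
  refine (h S.smooth_f).add (continuous_finsetSum _ fun j _ => ?_)
  have hu : Continuous fun z : Vec n × Vec m => z.2 j := by fun_prop
  exact hu.smul (h (S.contDiff_gcol j))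

/-- Along a closed-loop trajectory, a matrix-valued function evolves by `matDot`. -/
theorem hasDerivWithinAt_comp_closedLoop (S : ControlAffineSystem n m) {M : Vec n → Mat p}
    (hM : ∀ a b, ContDiff ℝ ∞ fun x => M x a b) {k : Vec n → Vec m} {x : ℝ → Vec n}
    {s : Set ℝ} {t : ℝ} (hx : HasDerivWithinAt x (S.closedLoop k (x t)) s t) (a b : Fin p) :
    HasDerivWithinAt (fun t => M (x t) a b) (matDot S M (x t) (k (x t)) a b) s t := by
  have h1 : HasFDerivAt (fun y => M y a b) (fderiv ℝ (fun y => M y a b) (x t)) (x t) :=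
    ((hM a b).differentiable (by simp) (x t)).hasFDerivAt
  have h2 := h1.comp_hasDerivWithinAt t hx
  refine h2.congr_deriv ?_
  have h3 : S.closedLoop k (x t) = S.f (x t) + ∑ j, (k (x t)) j • S.gcol j (x t) := by
    rw [ControlAffineSystem.closedLoop]
    congr 1
    ext i
    simp [mulVec, dotProduct, ControlAffineSystem.gcol, mul_comm]
  rw [h3, map_add, map_sum]
  simp only [map_smul, matDot, Matrix.add_apply, Matrix.sum_apply, Matrix.smul_apply, lieDeriv,
    of_apply]

theorem Psi_succ (S : ControlAffineSystem n m) (H : Vec n → Mat p) (α : ℕ → ℝ → ℝ) {i : ℕ}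
    (hi : 1 ≤ i) (x : Vec n) :
    Psi S H α (i + 1) x = lieDeriv S.f (Psi S H α i) x + cfc (α i) (Psi S H α i x) := by
  obtain ⟨j, rfl⟩ : ∃ j, i = j + 1 := ⟨i - 1, by omega⟩
  rfl

/-- Smoothness and symmetry go together: `contDiff_cfc` needs both at level `i` to yield smoothness
at level `i + 1`. -/
theorem IsHighOrderData.smooth_symm_Psi {S : ControlAffineSystem n m} {H : Vec n → Mat p}
    {α : ℕ → ℝ → ℝ} {r : ℕ} (hd : IsHighOrderData S H α r) {i : ℕ} (hi : 1 ≤ i) :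
    i ≤ r → (∀ a b, ContDiff ℝ ∞ fun x => Psi S H α i x a b) ∧
      ∀ x, (Psi S H α i x).IsSymm := by
  induction i, hi using Nat.le_induction with
  | base => exact fun _ => ⟨hd.smooth, hd.symm⟩
  | succ i hi ih =>
    intro hir
    obtain ⟨h1, h2⟩ := ih (by omega)
    refine ⟨fun a b => ?_, fun x => ?_⟩
    · simp only [Psi_succ S H α hi]
      exact (contDiff_lieDeriv_apply S.smooth_f h1 a b).add
        (contDiff_cfc h1 h2 (hd.smooth_classK i hi (by omega)) a b)
    · rw [Psi_succ S H α hi]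
      exact (lieDeriv_isSymm h2 _ x).add (cfc_isSymm (h2 x) _)

/-! ### The matrix comparison principle. -/

theorem dotProduct_self_pos {v : Fin p → ℝ} (hv : v ≠ 0) : 0 < v ⬝ᵥ v :=
  lt_of_le_of_ne (Finset.sum_nonneg fun i _ => mul_self_nonneg (v i))
    fun h => hv (dotProduct_self_eq_zero.1 h.symm)

theorem deriv_nonpos_of_left_min {h : ℝ → ℝ} {h' a c : ℝ} (hac : a < c)
    (hd : HasDerivWithinAt h h' (Ico a c) c) (hh : ∀ t ∈ Ico a c, h c ≤ h t) : h' ≤ 0 := by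
  rw [hasDerivWithinAt_iff_tendsto_slope, sdiff_singleton_eq_self (by simp)] at hd
  have hne : (𝓝[Ico a c] c).NeBot := by
    rw [← mem_closure_iff_nhdsWithin_neBot, closure_Ico hac.ne]
    exact right_mem_Icc.2 hac.le
  refine le_of_tendsto hd ?_
  filter_upwards [self_mem_nhdsWithin] with t ht
  rw [slope_def_field]
  exact div_nonpos_of_nonneg_of_nonpos (sub_nonneg.2 (hh t ht)) (by linarith [ht.2])

theorem hasDerivWithinAt_dotProduct_mulVec {Y Y' : ℝ → Mat p} {s : Set ℝ} {t : ℝ}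
    (hY : ∀ i j, HasDerivWithinAt (fun t => Y t i j) (Y' t i j) s t) (v : Fin p → ℝ) :
    HasDerivWithinAt (fun t => v ⬝ᵥ (Y t *ᵥ v)) (v ⬝ᵥ (Y' t *ᵥ v)) s t := by
  simp only [dotProduct, mulVec]
  exact HasDerivWithinAt.fun_sum fun i _ => HasDerivWithinAt.const_mul _
    (HasDerivWithinAt.fun_sum fun j _ => (hY i j).mul_const _)

/-- A matrix comparison principle: a symmetric curve with `Y' ⪰ -θ α(Y)` that starts positive
semidefinite stays positive semidefinite. -/
theorem posSemidef_of_deriv_ge {a b : ℝ} {Y Y' : ℝ → Mat p} {θ : ℝ → ℝ} {α : ℝ → ℝ}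
    (hα : IsExtendedClassK α)
    (hY : ∀ t ∈ Icc a b, ∀ i j, HasDerivWithinAt (fun t => Y t i j) (Y' t i j) (Icc a b) t)
    (hs : ∀ t, (Y t).IsSymm) (hθ : ∀ t ∈ Icc a b, 0 ≤ θ t)
    (hb : ∀ t ∈ Icc a b, (Y' t - -(θ t • cfc α (Y t))).PosSemidef) (ha : (Y a).PosSemidef) :
    ∀ t ∈ Icc a b, (Y t).PosSemidef := by
  -- The `1` makes the perturbed form positive already at `t = a`; the growth in `t` gives the
  -- strict derivative that yields the contradiction.
  let φ : ℝ → ℝ × (Fin p → ℝ) → ℝ := fun ε z =>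
    z.2 ⬝ᵥ (Y z.1 *ᵥ z.2) + ε * (1 + z.1 - a) * (z.2 ⬝ᵥ z.2)
  have hφc : ∀ ε, ContinuousOn (φ ε) (Icc a b ×ˢ univ) := by
    intro ε
    have hYc : ∀ i j, ContinuousOn (fun z : ℝ × (Fin p → ℝ) => Y z.1 i j) (Icc a b ×ˢ univ) :=
      fun i j => ContinuousOn.comp (g := fun t => Y t i j)
        (fun t ht => (hY t ht i j).continuousWithinAt) continuousOn_fst fun z hz => hz.1
    refine ContinuousOn.add ?_ (Continuous.continuousOn (by fun_prop))
    simp only [dotProduct, mulVec]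
    refine continuousOn_finsetSum _ fun i _ => ContinuousOn.mul
      (Continuous.continuousOn (by fun_prop)) (continuousOn_finsetSum _ fun j _ =>
        (hYc i j).mul (Continuous.continuousOn (by fun_prop)))
  have key : ∀ ε > 0, ∀ t ∈ Icc a b, ∀ v : Fin p → ℝ, ‖v‖ = 1 → 0 < φ ε (t, v) := by
    intro ε hε
    by_contra! hcon
    obtain ⟨t₀, ht₀, v₀, hv₀, hφ₀⟩ := hcon
    set s : Set (ℝ × (Fin p → ℝ)) := Icc a b ×ˢ Metric.sphere 0 1 with hsdef
    have hsc : IsCompact s := isCompact_Icc.prod (isCompact_sphere 0 1)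
    have hK : IsCompact (s ∩ φ ε ⁻¹' Iic 0) :=
      hsc.of_isClosed_subset (((hφc ε).mono (prod_mono_right (subset_univ _))
        ).preimage_isClosed_of_isClosed hsc.isClosed isClosed_Iic) inter_subset_left
    -- A first failure time, by compactness. The sphere is that of the sup norm; only its
    -- compactness and homogeneity of the form are needed.
    obtain ⟨⟨t₁, v₁⟩, ⟨⟨ht₁, hv₁⟩, hφ₁⟩, hmin⟩ := hK.exists_isMinOn
      ⟨(t₀, v₀), ⟨ht₀, by simpa using hv₀⟩, hφ₀⟩ continuous_fst.continuousOn
    simp only [mem_preimage, mem_Iic] at hφ₁ ht₁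
    have hne : ∀ v : Fin p → ℝ, ‖v‖ = 1 → v ≠ 0 := fun v hv h => by simp [h] at hv
    have hv₁' : ‖v₁‖ = 1 := by simpa using hv₁
    have hpos₁ := dotProduct_self_pos (hne v₁ hv₁')
    have hbefore : ∀ t ∈ Ico a t₁, ∀ v : Fin p → ℝ, ‖v‖ = 1 → 0 < φ ε (t, v) := by
      intro t ht v hv
      by_contra! hle
      have := hmin (a := (t, v)) ⟨⟨⟨ht.1, ht.2.le.trans ht₁.2⟩, by simpa using hv⟩, hle⟩
      exact absurd ht.2 (not_lt.2 this)
    have hat₁ : a < t₁ := by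
      refine lt_of_le_of_ne ht₁.1 fun h => ?_
      have h1 := (posSemidef_iff_real.1 ha).2 v₁
      rw [← h] at hφ₁
      simp only [φ, add_sub_cancel_right, mul_one] at hφ₁
      nlinarith
    have hsub : Ico a t₁ ⊆ Icc a b := fun t ht => ⟨ht.1, ht.2.le.trans ht₁.2⟩
    have hat : ∀ v : Fin p → ℝ, ‖v‖ = 1 → 0 ≤ φ ε (t₁, v) := by
      intro v hv
      have hc : ContinuousWithinAt (fun t => φ ε (t, v)) (Ico a t₁) t₁ := by
        have := (hφc ε).comp (f := fun t : ℝ => (t, v)) (s := Icc a b)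
          (by fun_prop) fun t ht => ⟨ht, mem_univ _⟩
        exact (this t₁ ht₁).mono hsub
      have hne' : (𝓝[Ico a t₁] t₁).NeBot := by
        rw [← mem_closure_iff_nhdsWithin_neBot, closure_Ico hat₁.ne]
        exact right_mem_Icc.2 hat₁.le
      refine ge_of_tendsto hc ?_
      filter_upwards [self_mem_nhdsWithin] with t ht using (hbefore t ht v hv).le
    set μ := -(ε * (1 + t₁ - a)) with hμ
    have hμ0 : μ < 0 := by
      have : 0 < 1 + t₁ - a := by linarith
      rw [hμ]; nlinarith [mul_pos hε this]
    set Z : Mat p := Y t₁ - μ • (1 : Mat p) with hZ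
    have hZq : ∀ v, v ⬝ᵥ (Z *ᵥ v) = φ ε (t₁, v) := by
      intro v
      simp only [hZ, sub_mulVec, dotProduct_sub, smul_mulVec, one_mulVec, dotProduct_smul,
        smul_eq_mul, hμ, φ]
      ring
    have hZpsd : Z.PosSemidef := by
      refine posSemidef_iff_real.2 ⟨(hs t₁).sub ((isSymm_one).smul μ), fun v => ?_⟩
      by_cases hv : v = 0
      · simp [hv]
      · have hn : 0 < ‖v‖ := norm_pos_iff.2 hv
        have h1 : v = ‖v‖ • (‖v‖⁻¹ • v) := by
          rw [smul_smul, mul_inv_cancel₀ hn.ne', one_smul]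
        have h2 := hat (‖v‖⁻¹ • v) (by rw [norm_smul, norm_inv, norm_norm, inv_mul_cancel₀ hn.ne'])
        rw [← hZq] at h2
        rw [h1, mulVec_smul, dotProduct_smul, smul_dotProduct]
        exact mul_nonneg hn.le (mul_nonneg hn.le h2)
    -- A null vector of a positive semidefinite form lies in the kernel, so `v₁` is an eigenvector
    -- of `Y t₁`.
    have hZ0 : Z *ᵥ v₁ = 0 := by
      have h1 : star v₁ ⬝ᵥ (Z *ᵥ v₁) = 0 := by
        rw [star_trivial, hZq]
        exact le_antisymm hφ₁ (hat v₁ hv₁')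
      exact (hZpsd.dotProduct_mulVec_zero_iff v₁).1 h1
    have heig : Y t₁ *ᵥ v₁ = μ • v₁ := by
      rw [hZ, sub_mulVec, smul_mulVec, one_mulVec, sub_eq_zero] at hZ0
      exact hZ0
    have hcfc := cfc_mulVec_of_eigenvector (hs t₁) α heig
    have hαμ : α μ ≤ 0 := by
      rw [← hα.map_zero]; exact (hα.strictMono hμ0).le
    have hY'pos : 0 ≤ v₁ ⬝ᵥ (Y' t₁ *ᵥ v₁) := by
      have h1 := (posSemidef_iff_real.1 (hb t₁ ht₁)).2 v₁
      rw [sub_neg_eq_add, add_mulVec, smul_mulVec, hcfc, dotProduct_add, dotProduct_smul,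
        dotProduct_smul, smul_eq_mul, smul_eq_mul] at h1
      have h2 : θ t₁ * (α μ * (v₁ ⬝ᵥ v₁)) ≤ 0 :=
        mul_nonpos_of_nonneg_of_nonpos (hθ t₁ ht₁)
          (mul_nonpos_of_nonpos_of_nonneg hαμ hpos₁.le)
      linarith
    have hder : HasDerivWithinAt (fun t => φ ε (t, v₁))
        (v₁ ⬝ᵥ (Y' t₁ *ᵥ v₁) + ε * (v₁ ⬝ᵥ v₁)) (Ico a t₁) t₁ := by
      refine HasDerivWithinAt.add (hasDerivWithinAt_dotProduct_mulVec
        (fun i j => (hY t₁ ht₁ i j).mono hsub) v₁) ?_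
      have := ((((hasDerivAt_id t₁).const_add 1).sub_const a).const_mul ε).hasDerivWithinAt
        (s := Ico a t₁)
      rw [mul_one] at this
      exact this.mul_const (v₁ ⬝ᵥ v₁)
    have hle := deriv_nonpos_of_left_min hat₁ hder fun t ht =>
      hφ₁.trans (hbefore t ht v₁ hv₁').le
    nlinarith [mul_pos hε hpos₁]
  intro t ht
  refine posSemidef_iff_real.2 ⟨hs t, fun v => ?_⟩
  by_cases hv : v = 0
  · simp [hv]
  have hn : 0 < ‖v‖ := norm_pos_iff.2 hv
  set w := ‖v‖⁻¹ • v with hw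
  have hwn : ‖w‖ = 1 := by rw [hw, norm_smul, norm_inv, norm_norm, inv_mul_cancel₀ hn.ne']
  have h1 : v = ‖v‖ • w := by
    rw [hw, smul_smul, mul_inv_cancel₀ hn.ne', one_smul]
  have h2 : 0 ≤ w ⬝ᵥ (Y t *ᵥ w) := by
    set c := (1 + t - a) * (w ⬝ᵥ w) with hc
    have hlim : Tendsto (fun ε : ℝ => w ⬝ᵥ (Y t *ᵥ w) + ε * c) (𝓝[>] 0)
        (𝓝 (w ⬝ᵥ (Y t *ᵥ w) + 0 * c)) :=
      (Continuous.tendsto (by fun_prop) 0).mono_left nhdsWithin_le_nhds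
    rw [zero_mul, add_zero] at hlim
    refine ge_of_tendsto hlim ?_
    filter_upwards [self_mem_nhdsWithin] with ε hε
    have := key ε hε t ht w hwn
    simp only [φ] at this
    rw [hc, ← mul_assoc]
    exact this.le
  rw [h1, mulVec_smul, dotProduct_smul, smul_dotProduct]
  exact mul_nonneg hn.le (mul_nonneg hn.le h2)

end MatrixCBF

/-! ### Forward invariance from a barrier inequality near the safe set. -/

namespace MatrixCBF

open Matrix Filter Topology Set

variable {n m p : ℕ}

theorem isClosed_setOf_posSemidef {X : Type*} [TopologicalSpace X] {M : X → Mat p}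
    (hM : Continuous M) (hs : ∀ x, (M x).IsSymm) : IsClosed {x | (M x).PosSemidef} := by
  have : {x | (M x).PosSemidef} = ⋂ v : Fin p → ℝ, {x | 0 ≤ v ⬝ᵥ (M x *ᵥ v)} := by
    ext x
    simp [posSemidef_iff_real, hs x]
  rw [this]
  exact isClosed_iInter fun v => isClosed_le continuous_const
    (continuous_const.dotProduct (hM.matrix_mulVec continuous_const))

variable {S : ControlAffineSystem n m} {H : Vec n → Mat p} {α : ℕ → ℝ → ℝ} {r : ℕ}

theorem IsHighOrderData.continuous_Psi (hd : IsHighOrderData S H α r) {i : ℕ} (hi : 1 ≤ i)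
    (hir : i ≤ r) : Continuous (Psi S H α i) :=
  continuous_matrix fun a b => ((hd.smooth_symm_Psi hi hir).1 a b).continuous

theorem IsHighOrderData.isClosed_safeSet (hd : IsHighOrderData S H α r) :
    IsClosed (safeSet S H α r) :=
  isClosed_biInter fun _ hi => isClosed_setOf_posSemidef (hd.continuous_Psi hi.1 hi.2)
    (hd.smooth_symm_Psi hi.1 hi.2).2

theorem mem_safeSet {x : Vec n} :
    x ∈ safeSet S H α r ↔ ∀ i, 1 ≤ i → i ≤ r → (Psi S H α i x).PosSemidef := by
  simp [safeSet]

/-- As long as the trajectory stays where the barrier inequality holds, it stays in the set. -/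
theorem mem_safeSet_of_barrier (hd : IsHighOrderData S H α r) {αr : ℝ → ℝ}
    (hαr : IsExtendedClassK αr) {k : Vec n → Vec m} {θ : Vec n → ℝ} {x : ℝ → Vec n} {a b : ℝ}
    (hx : ∀ t ∈ Icc a b, HasDerivWithinAt x (S.closedLoop k (x t)) (Icc a b) t)
    (hθ : ∀ t ∈ Icc a b, 0 ≤ θ (x t))
    (hb : ∀ t ∈ Icc a b, (matDot S (Psi S H α r) (x t) (k (x t))
      - -(θ (x t) • cfc αr (Psi S H α r (x t)))).PosSemidef)
    (ha : x a ∈ safeSet S H α r) : ∀ t ∈ Icc a b, x t ∈ safeSet S H α r := by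
  -- Induction on the distance `d` to the top level. Below the top, the comparison principle is used
  -- with `θ = 1`.
  have hlevel : ∀ d i, i + d = r → 1 ≤ i → ∀ t ∈ Icc a b, (Psi S H α i (x t)).PosSemidef := by
    intro d
    induction d with
    | zero =>
      rintro i rfl hi
      obtain ⟨h1, h2⟩ := hd.smooth_symm_Psi hi le_rfl
      exact posSemidef_of_deriv_ge hαr
        (fun t ht u v => hasDerivWithinAt_comp_closedLoop S h1 (hx t ht) u v)
        (fun t => h2 _) hθ hb (mem_safeSet.1 ha i hi le_rfl)
    | succ d ih =>
      intro i hid hi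
      have hir : i < r := by omega
      obtain ⟨h1, h2⟩ := hd.smooth_symm_Psi hi hir.le
      refine posSemidef_of_deriv_ge (θ := fun _ => 1) (hd.classK i hi hir)
        (fun t ht u v => hasDerivWithinAt_comp_closedLoop S h1 (hx t ht) u v)
        (fun t => h2 _) (fun _ _ => zero_le_one) (fun t ht => ?_)
        (mem_safeSet.1 ha i hi hir.le)
      have h3 := ih (i + 1) (by omega) (by omega) t ht
      rw [Psi_succ S H α hi] at h3
      simpa [matDot, hd.input_vanishes i hi hir] using h3
  intro t ht
  exact mem_safeSet.2 fun i hi hir => hlevel (r - i) i (by omega) hi t ht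

/-- A feedback that satisfies the relaxed barrier inequality on a neighborhood of the safe set
renders it forward invariant. -/
theorem forwardInvariant_of_barrier (hd : IsHighOrderData S H α r) {αr : ℝ → ℝ}
    (hαr : IsExtendedClassK αr) {k : Vec n → Vec m} {θ : Vec n → ℝ} {U : Set (Vec n)}
    (hU : IsOpen U) (hCU : safeSet S H α r ⊆ U) (hθ : ∀ x ∈ U, 0 ≤ θ x)
    (hb : ∀ x ∈ U, (matDot S (Psi S H α r) x (k x)
      - -(θ x • cfc αr (Psi S H α r x))).PosSemidef) :
    ForwardInvariant (S.closedLoop k) (safeSet S H α r) := by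
  intro T x hx h0
  have hxc : ContinuousOn x (Icc 0 T) := fun t ht => (hx t ht).continuousWithinAt
  have hcl : IsClosed (x ⁻¹' safeSet S H α r ∩ Icc 0 T) := by
    rw [inter_comm]
    exact hxc.preimage_isClosed_of_isClosed isClosed_Icc hd.isClosed_safeSet
  -- Continuous induction: the good times form a closed set, and from each of them the trajectory
  -- remains in `U` for a short while.
  refine hcl.Icc_subset_of_forall_exists_gt h0 ?_
  rintro t₀ ⟨ht₀, ht₀T⟩ y hy
  have hev : ∀ᶠ t in 𝓝[Icc 0 T] t₀, x t ∈ U :=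
    (hxc t₀ ⟨ht₀T.1, ht₀T.2.le⟩).eventually (hU.mem_nhds (hCU ht₀))
  obtain ⟨δ, hδ, hball⟩ := Metric.mem_nhdsWithin_iff.1 hev
  set t₁ := min (min y T) (t₀ + δ / 2) with ht₁
  have h01 : t₀ < t₁ := lt_min (lt_min hy ht₀T.2) (by linarith)
  have h1y : t₁ ≤ y := (min_le_left _ _).trans (min_le_left _ _)
  have h1T : t₁ ≤ T := (min_le_left _ _).trans (min_le_right _ _)
  have h1δ : t₁ ≤ t₀ + δ / 2 := min_le_right _ _
  have hsub : Icc t₀ t₁ ⊆ Icc 0 T := fun t ht => ⟨ht₀T.1.trans ht.1, ht.2.trans h1T⟩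
  have hxU : ∀ t ∈ Icc t₀ t₁, x t ∈ U := fun t ht => hball
    ⟨by rw [Metric.mem_ball, Real.dist_eq, abs_of_nonneg (by linarith [ht.1])]; linarith [ht.2],
      hsub ht⟩
  exact ⟨t₁, mem_safeSet_of_barrier hd hαr (fun t ht => (hx t (hsub ht)).mono hsub)
    (fun t ht => hθ _ (hxU t ht)) (fun t ht => hb _ (hxU t ht)) ht₀ t₁ (right_mem_Icc.2 h01.le),
    h01, h1y⟩

end MatrixCBF

/-! ### The semidefinite program: existence, uniqueness and continuity. -/

namespace MatrixCBF

open Matrix Filter Topology Set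

variable {n m p : ℕ}

/-- Positivity on the compact unit sphere persists under small perturbations and extends to all
vectors by homogeneity. -/
theorem isOpen_setOf_posDef {X : Type*} [TopologicalSpace X] {M : X → Mat p}
    (hM : Continuous M) (hs : ∀ x, (M x).IsSymm) : IsOpen {x | (M x).PosDef} := by
  rw [isOpen_iff_mem_nhds]
  intro x₀ hx₀
  have hc : Continuous fun z : X × (Fin p → ℝ) => z.2 ⬝ᵥ (M z.1 *ᵥ z.2) :=
    continuous_snd.dotProduct ((hM.comp continuous_fst).matrix_mulVec continuous_snd)
  have h1 : ∀ᶠ x in 𝓝 x₀, ∀ v ∈ Metric.sphere (0 : Fin p → ℝ) 1, 0 < v ⬝ᵥ (M x *ᵥ v) := by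
    refine (isCompact_sphere _ _).eventually_forall_of_forall_eventually fun v hv => ?_
    have hv0 : v ≠ 0 := fun h => by simp [h] at hv
    exact (hc.continuousAt (x := (x₀, v))).eventually
      (lt_mem_nhds ((posDef_iff_real.1 hx₀).2 v hv0))
  filter_upwards [h1] with x hx
  refine posDef_iff_real.2 ⟨hs x, fun v hv => ?_⟩
  have hn : 0 < ‖v‖ := norm_pos_iff.2 hv
  have h2 : v = ‖v‖ • (‖v‖⁻¹ • v) := by rw [smul_smul, mul_inv_cancel₀ hn.ne', one_smul]
  have h3 := hx (‖v‖⁻¹ • v) (by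
    rw [mem_sphere_zero_iff_norm, norm_smul, norm_inv, norm_norm, inv_mul_cancel₀ hn.ne'])
  rw [h2, mulVec_smul, dotProduct_smul, smul_dotProduct]
  exact mul_pos hn (mul_pos hn h3)

/-- The constraint matrix `dot M (x, u) + ω α(M(x))` of the semidefinite program. -/
noncomputable def constraintMatrix (S : ControlAffineSystem n m) (M : Vec n → Mat p) (αr : ℝ → ℝ) (x : Vec n)
    (z : Vec m × ℝ) : Mat p :=
  matDot S M x z.1 - -(z.2 • cfc αr (M x))

theorem constraintMatrix_isSymm (S : ControlAffineSystem n m) {M : Vec n → Mat p}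
    (hs : ∀ x, (M x).IsSymm) (αr : ℝ → ℝ) (x : Vec n) (z : Vec m × ℝ) :
    (constraintMatrix S M αr x z).IsSymm :=
  (matDot_isSymm S hs x z.1).sub ((cfc_isSymm (hs x) αr).smul z.2).neg

theorem continuous_constraintMatrix (S : ControlAffineSystem n m) {M : Vec n → Mat p}
    (hM : ∀ a b, ContDiff ℝ ∞ fun x => M x a b) (hs : ∀ x, (M x).IsSymm) {αr : ℝ → ℝ}
    (hα : Continuous αr) :
    Continuous fun y : Vec n × (Vec m × ℝ) => constraintMatrix S M αr y.1 y.2 := by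
  have h1 : Continuous fun y : Vec n × (Vec m × ℝ) => matDot S M y.1 y.2.1 :=
    (continuous_matDot S hM).comp (continuous_fst.prodMk (continuous_fst.comp continuous_snd))
  have hMc : Continuous M := continuous_matrix fun a b => (hM a b).continuous
  have h2 : Continuous fun y : Vec n × (Vec m × ℝ) => cfc αr (M y.1) :=
    (continuous_cfc_of_isSymm hMc hs hα).comp continuous_fst
  have h3 : Continuous fun y : Vec n × (Vec m × ℝ) => y.2.2 := by fun_prop
  exact h1.sub (h3.smul h2).neg

theorem constraintMatrix_combo (S : ControlAffineSystem n m) (M : Vec n → Mat p) (αr : ℝ → ℝ)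
    (x : Vec n) (z z' : Vec m × ℝ) {s t : ℝ} (hst : s + t = 1) :
    constraintMatrix S M αr x (s • z + t • z')
      = s • constraintMatrix S M αr x z + t • constraintMatrix S M αr x z' := by
  obtain rfl : s = 1 - t := by linarith
  have h : ∀ L : Fin m → Mat p, ∑ j, ((1 - t) • z.1 + t • z'.1) j • L j
      = (1 - t) • ∑ j, z.1 j • L j + t • ∑ j, z'.1 j • L j := by
    intro L
    rw [Finset.smul_sum, Finset.smul_sum, ← Finset.sum_add_distrib]
    refine Finset.sum_congr rfl fun j _ => ?_
    simp only [PiLp.add_apply, PiLp.smul_apply, smul_eq_mul]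
    module
  simp only [constraintMatrix, matDot, Prod.fst_add, Prod.snd_add, Prod.smul_fst, Prod.smul_snd,
    h, smul_eq_mul]
  module

variable {S : ControlAffineSystem n m} {H : Vec n → Mat p} {α : ℕ → ℝ → ℝ} {r : ℕ}
  {αr : ℝ → ℝ} {knom : Vec n → Vec m} {w θd : ℝ}

theorem mem_sdpFeasible {x : Vec n} {z : Vec m × ℝ} :
    z ∈ sdpFeasible S H α r αr θd x ↔ 0 ≤ z.2 ∧ θd ≤ z.2 ∧
      (constraintMatrix S (Psi S H α r) αr x z).PosSemidef := Iff.rfl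

theorem continuous_sdpCost (hk : Continuous knom) :
    Continuous fun y : Vec n × (Vec m × ℝ) => sdpCost knom w θd y.1 y.2 := by
  unfold sdpCost
  fun_prop

theorem continuous_sdpCost_right (x : Vec n) : Continuous fun z => sdpCost knom w θd x z := by
  unfold sdpCost
  fun_prop

theorem continuous_sdpCost_left (hk : Continuous knom) (z : Vec m × ℝ) :
    Continuous fun x => sdpCost knom w θd x z := by
  unfold sdpCost
  fun_prop

/-- Coercivity: the radii use `2s ≤ s² + 1` to avoid square roots. -/
theorem mem_of_sdpCost_le (hw : 0 < w) {x : Vec n} {z : Vec m × ℝ} {c : ℝ}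
    (hc : sdpCost knom w θd x z ≤ c) :
    z ∈ Metric.closedBall (knom x) (c + 1) ×ˢ Metric.closedBall θd (c / w + 1) := by
  unfold sdpCost at hc
  have h1 : 0 ≤ w * (z.2 - θd) ^ 2 := by positivity
  have h2 : 0 ≤ ‖z.1 - knom x‖ ^ 2 := by positivity
  constructor
  · rw [Metric.mem_closedBall, dist_eq_norm]
    nlinarith [sq_nonneg (‖z.1 - knom x‖ - 1)]
  · rw [Metric.mem_closedBall, Real.dist_eq]
    have h3 : |z.2 - θd| ^ 2 ≤ c / w := by
      rw [sq_abs, le_div_iff₀ hw]; linarith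
    nlinarith [sq_nonneg (|z.2 - θd| - 1)]

/-- Strict convexity in quantitative form, by the parallelogram law; the defect term forces two
minimizers to agree. -/
theorem sdpCost_midpoint (x : Vec n) (z z' : Vec m × ℝ) :
    sdpCost knom w θd x ((1 / 2 : ℝ) • z + (1 / 2 : ℝ) • z')
      = (sdpCost knom w θd x z + sdpCost knom w θd x z') / 2
        - (‖z.1 - z'.1‖ ^ 2 + w * (z.2 - z'.2) ^ 2) / 4 := by
  set a := z.1 - knom x with ha
  set b := z'.1 - knom x with hb
  have h1 : ((1 / 2 : ℝ) • z + (1 / 2 : ℝ) • z').1 - knom x = (1 / 2 : ℝ) • (a + b) := by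
    simp only [Prod.fst_add, Prod.smul_fst, ha, hb]
    module
  have h2 : z.1 - z'.1 = a - b := by simp [ha, hb]
  have h3 := parallelogram_law_with_norm ℝ a b
  simp only [sdpCost]
  rw [h1, h2, norm_smul, ← ha, ← hb]
  simp only [Prod.snd_add, Prod.smul_snd, smul_eq_mul, Real.norm_eq_abs]
  rw [abs_of_pos (by norm_num : (0 : ℝ) < 1 / 2)]
  linear_combination (1 / 4) * h3

theorem smul_add_smul_mem_sdpFeasible {x : Vec n} {z z' : Vec m × ℝ}
    (hz : z ∈ sdpFeasible S H α r αr θd x) (hz' : z' ∈ sdpFeasible S H α r αr θd x) {s t : ℝ}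
    (hs : 0 ≤ s) (ht : 0 ≤ t) (hst : s + t = 1) :
    s • z + t • z' ∈ sdpFeasible S H α r αr θd x := by
  obtain ⟨h1, h2, h3⟩ := mem_sdpFeasible.1 hz
  obtain ⟨h1', h2', h3'⟩ := mem_sdpFeasible.1 hz'
  refine mem_sdpFeasible.2 ⟨?_, ?_, ?_⟩
  · simp only [Prod.snd_add, Prod.smul_snd, smul_eq_mul]; positivity
  · simp only [Prod.snd_add, Prod.smul_snd, smul_eq_mul]
    obtain rfl : s = 1 - t := by linarith
    nlinarith [mul_le_mul_of_nonneg_left h2 hs, mul_le_mul_of_nonneg_left h2' ht]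
  · rw [constraintMatrix_combo S _ αr x z z' hst]
    exact (h3.smul hs).add (h3'.smul ht)

theorem IsSDPSolution.eq (hw : 0 < w) {x : Vec n} {z z' : Vec m × ℝ}
    (hz : IsSDPSolution S H α r αr knom w θd x z)
    (hz' : IsSDPSolution S H α r αr knom w θd x z') : z = z' := by
  have hmid := smul_add_smul_mem_sdpFeasible hz.1 hz'.1 (s := 1 / 2) (t := 1 / 2)
    (by norm_num) (by norm_num) (by norm_num)
  have h1 := isMinOn_iff.1 hz.2 _ hmid
  have h2 := isMinOn_iff.1 hz'.2 _ hmid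
  rw [sdpCost_midpoint] at h1 h2
  have h3 : 0 ≤ ‖z.1 - z'.1‖ ^ 2 := by positivity
  have h4 : 0 ≤ w * (z.2 - z'.2) ^ 2 := by positivity
  have h5 : ‖z.1 - z'.1‖ ^ 2 = 0 := by linarith
  have h6 : w * (z.2 - z'.2) ^ 2 = 0 := by linarith
  refine Prod.ext ?_ ?_
  · rwa [sq_eq_zero_iff, norm_eq_zero, sub_eq_zero] at h5
  · rcases mul_eq_zero.1 h6 with h | h
    · exact absurd h hw.ne'
    · rwa [sq_eq_zero_iff, sub_eq_zero] at h

theorem isClosed_setOf_mem_sdpFeasible (hd : IsHighOrderData S H α r) (hαr : Continuous αr) :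
    IsClosed {q : Vec n × (Vec m × ℝ) | q.2 ∈ sdpFeasible S H α r αr θd q.1} := by
  obtain ⟨hM, hs⟩ := hd.smooth_symm_Psi hd.one_le le_rfl
  have h2 := isClosed_setOf_posSemidef (continuous_constraintMatrix S hM hs hαr)
    fun q => constraintMatrix_isSymm S hs αr q.1 q.2
  have h0 : Continuous fun q : Vec n × (Vec m × ℝ) => q.2.2 := by fun_prop
  simp only [mem_sdpFeasible]
  exact (isClosed_le continuous_const h0).inter ((isClosed_le continuous_const h0).inter h2)

theorem exists_isSDPSolution (hd : IsHighOrderData S H α r) (hαr : Continuous αr) (hw : 0 < w) {x : Vec n}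
    (hne : (sdpFeasible S H α r αr θd x).Nonempty) :
    ∃ z, IsSDPSolution S H α r αr knom w θd x z := by
  obtain ⟨zs, hzs⟩ := hne
  have hcl : IsClosed (sdpFeasible S H α r αr θd x) :=
    (isClosed_setOf_mem_sdpFeasible hd hαr).preimage (Continuous.prodMk_right x)
  set B := Metric.closedBall (knom x) (sdpCost knom w θd x zs + 1) ×ˢ
    Metric.closedBall θd (sdpCost knom w θd x zs / w + 1) with hB
  have hK : IsCompact (sdpFeasible S H α r αr θd x ∩ B) :=
    ((isCompact_closedBall _ _).prod (isCompact_closedBall _ _)).inter_left hcl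
  have hcost := continuous_sdpCost_right (knom := knom) (w := w) (θd := θd) x
  have hzsB := mem_of_sdpCost_le hw (le_refl (sdpCost knom w θd x zs))
  obtain ⟨z, hz, hmin⟩ := hK.exists_isMinOn ⟨zs, hzs, hzsB⟩ hcost.continuousOn
  rw [isMinOn_iff] at hmin
  refine ⟨z, hz.1, isMinOn_iff.2 fun z' hz' => ?_⟩
  rcases le_or_gt (sdpCost knom w θd x z') (sdpCost knom w θd x zs) with h | h
  · exact hmin z' ⟨hz', mem_of_sdpCost_le hw h⟩
  · exact (hmin zs ⟨hzs, hzsB⟩).trans h.le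

/-- The states at which the semidefinite program is strictly feasible. -/
def slaterSet (S : ControlAffineSystem n m) (H : Vec n → Mat p) (α : ℕ → ℝ → ℝ) (r : ℕ)
    (αr : ℝ → ℝ) (θd : ℝ) : Set (Vec n) :=
  {x | ∃ z : Vec m × ℝ, 0 ≤ z.2 ∧ θd ≤ z.2 ∧
    (constraintMatrix S (Psi S H α r) αr x z).PosDef}

theorem eventually_posDef_constraintMatrix (hd : IsHighOrderData S H α r) (hαr : Continuous αr)
    {x : Vec n} {z : Vec m × ℝ} (h : (constraintMatrix S (Psi S H α r) αr x z).PosDef) :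
    ∀ᶠ y in 𝓝 x, (constraintMatrix S (Psi S H α r) αr y z).PosDef := by
  obtain ⟨hM, hs⟩ := hd.smooth_symm_Psi hd.one_le le_rfl
  have h1 : Continuous fun y : Vec n => constraintMatrix S (Psi S H α r) αr y z :=
    (continuous_constraintMatrix S hM hs hαr).comp (continuous_id.prodMk continuous_const)
  exact (isOpen_setOf_posDef h1 fun y => constraintMatrix_isSymm S hs αr y z).mem_nhds h

theorem isOpen_slaterSet (hd : IsHighOrderData S H α r) (hαr : Continuous αr) :
    IsOpen (slaterSet S H α r αr θd) := by
  rw [isOpen_iff_mem_nhds]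
  rintro x ⟨z, h1, h2, h3⟩
  filter_upwards [eventually_posDef_constraintMatrix hd hαr h3] with y hy using ⟨z, h1, h2, hy⟩

theorem IsODCertificate.safeSet_subset_slaterSet (hd : IsHighOrderData S H α r)
    (hOD : IsODCertificate S H α r αr) : safeSet S H α r ⊆ slaterSet S H α r αr θd := by
  intro x hx
  obtain ⟨u, c, hc, hpd⟩ := hOD.strict x hx
  -- Raising `c` to `max c θd` adds a nonnegative multiple of `α_r(Ψ_r(x)) ⪰ 0`, which preserves
  -- definiteness.
  refine ⟨(u, max c θd), hc.trans (le_max_left _ _), le_max_right _ _, ?_⟩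
  have h1 : (cfc αr (Psi S H α r x)).PosSemidef :=
    cfc_posSemidef (mem_safeSet.1 hx r hd.one_le le_rfl) fun t ht => by
      rw [← hOD.classK.map_zero]; exact hOD.classK.strictMono.monotone ht
  have h2 := hpd.add_posSemidef (h1.smul (sub_nonneg.2 (le_max_left c θd)))
  convert h2 using 1
  simp only [constraintMatrix]
  module

theorem slaterSet_subset_nonempty {x : Vec n} (hx : x ∈ slaterSet S H α r αr θd) :
    (sdpFeasible S H α r αr θd x).Nonempty := by
  obtain ⟨z, h1, h2, h3⟩ := hx
  exact ⟨z, h1, h2, h3.posSemidef⟩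

/-- The solution of the semidefinite program depends continuously on the state wherever the program
is strictly feasible. -/
theorem continuousAt_of_isSDPSolution (hd : IsHighOrderData S H α r) (hαr : Continuous αr)
    (hk : Continuous knom) (hw : 0 < w) {f : Vec n → Vec m × ℝ}
    (hf : ∀ x ∈ slaterSet S H α r αr θd, IsSDPSolution S H α r αr knom w θd x (f x))
    {x₀ : Vec n} (hx₀ : x₀ ∈ slaterSet S H α r αr θd) : ContinuousAt f x₀ := by
  have hU := (isOpen_slaterSet (θd := θd) hd hαr).mem_nhds hx₀
  obtain ⟨zs, hzs1, hzs2, hzs3⟩ := id hx₀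
  have hzs : zs ∈ sdpFeasible S H α r αr θd x₀ := ⟨hzs1, hzs2, hzs3.posSemidef⟩
  have hz₀ := hf x₀ hx₀
  have hcost := continuous_sdpCost (w := w) (θd := θd) hk
  -- The optimum itself may lie on the boundary of the constraint. Moving it slightly towards the
  -- Slater point `zs` makes it strictly feasible, hence feasible at all nearby states.
  let z : ℝ → Vec m × ℝ := fun t => (1 - t) • f x₀ + t • zs
  have hle : ∀ t ∈ Ioc (0 : ℝ) 1, ∀ᶠ x in 𝓝 x₀,
      sdpCost knom w θd x (f x) ≤ sdpCost knom w θd x (z t) := by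
    intro t ht
    obtain ⟨h1, h2, h3⟩ := mem_sdpFeasible.1 (smul_add_smul_mem_sdpFeasible hz₀.1 hzs
      (sub_nonneg.2 ht.2) ht.1.le (sub_add_cancel 1 t))
    have hpd : (constraintMatrix S (Psi S H α r) αr x₀ (z t)).PosDef := by
      rw [constraintMatrix_combo S _ αr x₀ _ _ (sub_add_cancel 1 t)]
      exact PosDef.posSemidef_add ((mem_sdpFeasible.1 hz₀.1).2.2.smul (sub_nonneg.2 ht.2))
        (hzs3.smul ht.1)
    filter_upwards [hU, eventually_posDef_constraintMatrix hd hαr hpd] with x hxU hx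
    exact isMinOn_iff.1 (hf x hxU).2 _ (mem_sdpFeasible.2 ⟨h1, h2, hx.posSemidef⟩)
  set c := sdpCost knom w θd x₀ (z 1) + 1 with hc
  have hcx : ∀ v, Continuous fun x => sdpCost knom w θd x v := 
    continuous_sdpCost_left hk
  have hK : ∀ᶠ x in 𝓝 x₀, f x ∈
      Metric.closedBall (knom x₀) (c + 2) ×ˢ Metric.closedBall θd (c / w + 1) := by
    have h1 : ∀ᶠ x in 𝓝 x₀, sdpCost knom w θd x (z 1) < c :=
      (hcx (z 1)).continuousAt.eventually (gt_mem_nhds (by simp [hc]))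
    have h2 : ∀ᶠ x in 𝓝 x₀, dist (knom x) (knom x₀) < 1 :=
      hk.continuousAt.eventually (Metric.ball_mem_nhds _ one_pos)
    filter_upwards [hle 1 (by simp), h1, h2] with x h3 h4 h5
    obtain ⟨h6, h7⟩ := mem_of_sdpCost_le hw (h3.trans h4.le)
    refine ⟨?_, h7⟩
    rw [Metric.mem_closedBall] at h6 ⊢
    linarith [dist_triangle (f x).1 (knom x) (knom x₀)]
  -- Near `x₀` the solutions stay in a compact set, so it suffices that every cluster point `y` is
  -- optimal at `x₀`: uniqueness then gives `y = f x₀`.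
  refine ((isCompact_closedBall _ _).prod
    (isCompact_closedBall _ _)).tendsto_nhds_of_unique_mapClusterPt hK fun y _ hy => ?_
  obtain ⟨F, hF, hFy⟩ := mapClusterPt_iff_ultrafilter.1 hy
  have hpair : Tendsto (fun x => (x, f x)) F (𝓝 (x₀, y)) :=
    (tendsto_id'.2 hF).prodMk_nhds hFy
  have hfeas : y ∈ sdpFeasible S H α r αr θd x₀ := by
    have hcl := isClosed_setOf_mem_sdpFeasible (θd := θd) hd hαr
    refine hcl.mem_of_tendsto hpair ?_
    filter_upwards [hF hU] with x hx using (hf x hx).1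
  have hyt : ∀ t ∈ Ioc (0 : ℝ) 1,
      sdpCost knom w θd x₀ y ≤ sdpCost knom w θd x₀ (z t) := by
    intro t ht
    exact le_of_tendsto_of_tendsto ((hcost.tendsto (x₀, y)).comp hpair)
      (((hcx (z t)).tendsto x₀).mono_left hF) (hF (hle t ht))
  -- Let `t → 0`, so that the competitor `z t` returns to `f x₀`.
  have hy0 : sdpCost knom w θd x₀ y ≤ sdpCost knom w θd x₀ (f x₀) := by
    have hzt : Continuous z := by fun_prop
    have hzc : Continuous fun t => sdpCost knom w θd x₀ (z t) :=
      (continuous_sdpCost_right x₀).comp hzt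
    have h1 : Tendsto (fun t => sdpCost knom w θd x₀ (z t)) (𝓝[>] 0)
        (𝓝 (sdpCost knom w θd x₀ (z 0))) := (hzc.tendsto 0).mono_left nhdsWithin_le_nhds
    have h2 : z 0 = f x₀ := by simp [z]
    rw [h2] at h1
    refine ge_of_tendsto h1 ?_
    filter_upwards [Ioc_mem_nhdsGT (zero_lt_one' ℝ)] with t ht using hyt t ht
  exact IsSDPSolution.eq hw ⟨hfeas, isMinOn_iff.2 fun z' hz' =>
    hy0.trans (isMinOn_iff.1 hz₀.2 z' hz')⟩ hz₀

end MatrixCBF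

theorem mainTheorem2 {n m p : ℕ} (S : MatrixCBF.ControlAffineSystem n m)
    (H : MatrixCBF.Vec n → MatrixCBF.Mat p) (α : ℕ → ℝ → ℝ) (r : ℕ) (αr : ℝ → ℝ)
    (hdata : MatrixCBF.IsHighOrderData S H α r)
    (hOD : MatrixCBF.IsODCertificate S H α r αr) :
    -- every continuous feedback satisfying the relaxed barrier inequality near the set
    (∀ (k : MatrixCBF.Vec n → MatrixCBF.Vec m) (θ : MatrixCBF.Vec n → ℝ),
      Continuous k → (∀ x, 0 ≤ θ x) →
      (∃ U : Set (MatrixCBF.Vec n), IsOpen U ∧ MatrixCBF.safeSet S H α r ⊆ U ∧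
        ∀ x ∈ U, (MatrixCBF.matDot S (MatrixCBF.Psi S H α r) x (k x)
          - -(θ x • cfc αr (MatrixCBF.Psi S H α r x))).PosSemidef) →
      MatrixCBF.ForwardInvariant (S.closedLoop k) (MatrixCBF.safeSet S H α r)) ∧
    -- the semidefinite-programming filter
    (∀ (knom : MatrixCBF.Vec n → MatrixCBF.Vec m) (w θd : ℝ), Continuous knom → 0 < w →
      ∃ U : Set (MatrixCBF.Vec n), IsOpen U ∧ MatrixCBF.safeSet S H α r ⊆ U ∧
        (∀ x ∈ U, ∃! z : MatrixCBF.Vec m × ℝ,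
          MatrixCBF.IsSDPSolution S H α r αr knom w θd x z) ∧
        ∀ (k : MatrixCBF.Vec n → MatrixCBF.Vec m) (θ : MatrixCBF.Vec n → ℝ),
          (∀ x ∈ U, MatrixCBF.IsSDPSolution S H α r αr knom w θd x (k x, θ x)) →
          ContinuousOn k U ∧ ContinuousOn θ U ∧
          MatrixCBF.ForwardInvariant (S.closedLoop k) (MatrixCBF.safeSet S H α r)) := by
  refine ⟨fun k θ _ hθ ⟨U, hU, hCU, hb⟩ => MatrixCBF.forwardInvariant_of_barrier hdata hOD.classK
    hU hCU (fun x _ => hθ x) hb, fun knom w θd hk hw => ?_⟩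
  have hαr := hOD.classK.continuous
  refine ⟨MatrixCBF.slaterSet S H α r αr θd, MatrixCBF.isOpen_slaterSet hdata hαr,
    hOD.safeSet_subset_slaterSet hdata, fun x hx => ?_, fun k θ hsol => ?_⟩
  · obtain ⟨z, hz⟩ := MatrixCBF.exists_isSDPSolution (knom := knom) hdata hαr hw
      (MatrixCBF.slaterSet_subset_nonempty hx)
    exact ⟨z, hz, fun z' hz' => hz'.eq hw hz⟩
  · have hc : ∀ x ∈ MatrixCBF.slaterSet S H α r αr θd, ContinuousAt (fun x => (k x, θ x)) x :=
      fun x hx => MatrixCBF.continuousAt_of_isSDPSolution hdata hαr hk hw hsol hx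
    refine ⟨fun x hx => (hc x hx).fst.continuousWithinAt,
      fun x hx => (hc x hx).snd.continuousWithinAt, ?_⟩
    exact MatrixCBF.forwardInvariant_of_barrier hdata hOD.classK
      (MatrixCBF.isOpen_slaterSet hdata hαr) (hOD.safeSet_subset_slaterSet hdata)
      (fun x hx => (hsol x hx).1.1) (fun x hx => (hsol x hx).1.2.2)
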